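/- A $2$-VASS $V$ consists of a finite alphabet $\Sigma$, a finite set of states $Q$, an initial configuration $c_0 \in Q\times\mathbb{N}^2$, a finite set of final configurations $F\subseteq Q\times\mathbb{N}^2$ and a finite transition relation $\delta\subseteq Q\times\Sigma\times\mathbb{Z}^2\times Q$. A transition $(s,a,v,s')\in\delta$ reads the letter $a$; it can be fired in a configuration $q(u)$ if and only if $q=s$ and $u+v\ge 0$ componentwise, and it then leads to $s'(u+v)$. A run is a finite sequence of transitions fired one after another. A run is accepting if it starts in $c_0$ and ends in a configuration $q(u)$ such that $u\ge u'$ componentwise for some $q(u')\in F$. The language $L(V)\subseteq\Sigma^*$ is the set of words read by accepting runs. $V$ is unambiguous if for every $w\in L(V)$ there is exactly one accepting run over $w$. The following problem is undecidable: given an unambiguous $2$-VASS $A$ and a (nondeterministic, i.e. arbitrary) $2$-VASS $B$ over the same finite alphabet, determine whether $L(A)=L(B)$. That is, no algorithm, given (finite descriptions of) any such $A$ and $B$, always halts and correctly decides whether $L(A)=L(B)$; nothing is required of the algorithm on inputs in which $A$ is not unambiguous. -/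

import Mathlib

/-- A `k`-dimensional vector addition system with states, over the finite alphabet `σ` and with the
finite set of states `Q`: an initial configuration, a finite set of final configurations and a
finite transition relation (source state, letter, effect, target state). -/
structure VASS (k : ℕ) (σ Q : Type*) [Finite σ] [Finite Q] where
  /-- the initial configuration -/
  init : Q × (Fin k → ℕ)
  /-- the finite set of final configurations -/
  final : Finset (Q × (Fin k → ℕ))
  /-- the transition relation -/
  trans : Finset (Q × σ × (Fin k → ℤ) × Q)

namespace VASS

/-- Configurations: a state together with a vector of nonnegative counter values. -/
abbrev Config (k : ℕ) (Q : Type*) := Q × (Fin k → ℕ)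

/-- Transitions: source state, letter, effect, target state. -/
abbrev Transition (k : ℕ) (σ Q : Type*) := Q × σ × (Fin k → ℤ) × Q

/-- The letter which a transition reads. -/
def Transition.letter {k : ℕ} {σ Q : Type*} (t : Transition k σ Q) : σ := t.2.1

/-- The transition `(s, a, v, s')` can be fired in the configuration `q(u)` iff `q = s` and
`u + v` is nonnegative; it then leads to the configuration `s'(u + v)`. -/
def Fires {k : ℕ} {σ Q : Type*} (t : Transition k σ Q) (c c' : Config k Q) : Prop :=
  match t with
  | (s, _, v, s') => c.1 = s ∧ c'.1 = s' ∧ ∀ i, (c'.2 i : ℤ) = (c.2 i : ℤ) + v i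

section Semantics

variable {k : ℕ} {σ Q : Type*} [Finite σ] [Finite Q]

/-- `V.IsRun c ρ c'`: the sequence `ρ` of transitions of `V` is a run from `c` to `c'`. -/
inductive IsRun (V : VASS k σ Q) : Config k Q → List (Transition k σ Q) → Config k Q → Prop
  | nil (c : Config k Q) : IsRun V c [] c
  | cons {t : Transition k σ Q} {c c' c'' : Config k Q} {ρ : List (Transition k σ Q)} :
      t ∈ V.trans → Fires t c c' → IsRun V c' ρ c'' → IsRun V c (t :: ρ) c''

/-- A configuration is accepting if it covers some final configuration. -/
def IsAccepting (V : VASS k σ Q) (c : Config k Q) : Prop :=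
  ∃ d ∈ V.final, d.1 = c.1 ∧ d.2 ≤ c.2

/-- `ρ` is an accepting run of `V` over the word `w`. -/
def IsAcceptingRun (V : VASS k σ Q) (w : List σ) (ρ : List (Transition k σ Q)) : Prop :=
  ρ.map Transition.letter = w ∧ ∃ c, V.IsRun V.init ρ c ∧ V.IsAccepting c

/-- The (coverability) language of `V`: the words read by the accepting runs. -/
def language (V : VASS k σ Q) : Language σ :=
  {w | ∃ ρ, V.IsAcceptingRun w ρ}

/-- `V` is unambiguous if every word of its language has exactly one accepting run. -/
def IsUnambiguous (V : VASS k σ Q) : Prop :=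
  ∀ w ∈ V.language, ∃! ρ, V.IsAcceptingRun w ρ

end Semantics

/-- Finite descriptions of `k`-dimensional VASSs, as inputs of algorithms: the number of letters,
the number of states, the initial configuration, a list of the final configurations and a list of
the transitions. Letters and states are written as natural numbers. -/
abbrev Code (k : ℕ) :=
  ℕ × ℕ × (ℕ × (Fin k → ℕ)) × List (ℕ × (Fin k → ℕ)) × List (ℕ × ℕ × (Fin k → ℤ) × ℕ)

/-- `Describes e V`: the code `e` is a description of `V`, a VASS with alphabet `{0, …, m - 1}` and
states `{0, …, n - 1}`. The finite sets of `V` may be listed in any order. -/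
def Describes {k m n : ℕ} (e : Code k) (V : VASS k (Fin m) (Fin n)) : Prop :=
  match e with
  | (m', n', c₀, F, δ) =>
    m' = m ∧ n' = n ∧ c₀ = ((V.init.1 : ℕ), V.init.2) ∧
    (∀ c, c ∈ F ↔ ∃ d ∈ V.final, c = ((d.1 : ℕ), d.2)) ∧
    (∀ t, t ∈ δ ↔ ∃ s ∈ V.trans, t = ((s.1 : ℕ), (s.2.1 : ℕ), s.2.2.1, (s.2.2.2 : ℕ)))

end VASS

/-! The halting problem is reduced to the question, through two-counter machines. Take the
instructions of such a machine as letters and let a DFA `D` accept its instruction sequences. A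
2-VASS cannot test for zero, but `weakMachine` runs `D` and treats zero tests as no-ops; it is
deterministic, hence unambiguous. An executable word is a genuine computation exactly if no zero
test meets a positive counter, and the failure of this can be recognised nondeterministically:
`cheatMachine` guesses one zero test, decrements the tested counter there, and gives the unit back
in the next transition. Its language always lies inside that of `weakMachine`, and the two agree iff
the machine has no genuine complete run (`weakMachine_language_eq_iff`).

It remains to find one fixed machine that has a complete run from `(2 ^ n, 0)` iff the `n`-th
program halts (`exists_definable_halting`). Machines are built as relations closed under
composition, union and iteration, which are the regular operations on control languages. Following
Minsky, the values of any number of registers become exponents of distinct primes in a single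
counter, with the other one as scratch space (`RegisterRel.exists_definable`). Register programs
that may guess can test the graph of every primitive recursive function (`Testable.eq_primrec`),
hence search for a halting time.

Only the initial counter vector depends on `n`, so the pair of descriptions is computable from `n`,
and an algorithm for language equality would decide halting. -/

/-! ### Regular languages under concatenation and star, by counting left quotients -/

namespace Language

variable {α : Type*}

theorem IsRegular.zero : (0 : Language α).IsRegular := by
  refine IsRegular.of_finite_range_leftQuotient ((Set.finite_singleton (0 : Language α)).subset ?_)
  rintro _ ⟨x, rfl⟩
  rw [Set.mem_singleton_iff]
  ext y
  simp [mem_leftQuotient, notMem_zero]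

theorem IsRegular.one : (1 : Language α).IsRegular := by
  refine IsRegular.of_finite_range_leftQuotient ((Set.toFinite {(0 : Language α), 1}).subset ?_)
  rintro _ ⟨x, rfl⟩
  rcases x with _ | ⟨b, x⟩
  · right
    ext y
    simp [mem_one]
  · left
    ext y
    simp [mem_leftQuotient, mem_one, notMem_zero]

theorem IsRegular.letter (a : α) : ({[a]} : Language α).IsRegular := by
  refine IsRegular.of_finite_range_leftQuotient
    ((Set.toFinite {(0 : Language α), 1, ({[a]} : Language α)}).subset ?_)
  rintro _ ⟨x, rfl⟩
  rcases x with _ | ⟨b, x⟩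
  · right; right
    rfl
  · by_cases h : b = a ∧ x = []
    · right; left
      obtain ⟨rfl, rfl⟩ := h
      ext y
      rw [mem_leftQuotient, mem_one]
      exact (Set.mem_singleton_iff).trans (by simp)
    · left
      ext y
      rw [mem_leftQuotient]
      refine (Set.mem_singleton_iff).trans ?_
      simp only [List.cons_append, List.cons.injEq, List.append_eq_nil_iff, notMem_zero, iff_false]
      tauto

/-- Either `x` ends inside the first factor, or it is a full first factor `a` followed by a prefix
`c` of the second. -/
theorem leftQuotient_mul (L₁ L₂ : Language α) (x : List α) :
    (L₁ * L₂).leftQuotient x = (L₁.leftQuotient x) * L₂ +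
      sSup {M : Language α | ∃ a c, x = a ++ c ∧ a ∈ L₁ ∧ M = L₂.leftQuotient c} := by
  ext y
  rw [mem_leftQuotient, mem_mul, mem_add, mem_mul]
  constructor
  · rintro ⟨a, ha, b, hb, hab⟩
    rcases List.append_eq_append_iff.1 hab with ⟨c, hx, hb'⟩ | ⟨c, hx, hy⟩
    · right
      refine Set.mem_sUnion.2 ⟨L₂.leftQuotient c, ⟨a, c, hx, ha, rfl⟩, ?_⟩
      change c ++ y ∈ L₂
      rwa [← hb']
    · left
      exact ⟨c, by rwa [mem_leftQuotient, ← hx], b, hb, hy.symm⟩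
  · rintro (⟨c, hc, b, hb, rfl⟩ | h)
    · exact ⟨x ++ c, hc, b, hb, by simp⟩
    · obtain ⟨_, ⟨a, c, rfl, ha, rfl⟩, h⟩ := Set.mem_sUnion.1 h
      exact ⟨a, ha, c ++ y, h, by simp⟩

/-- The end of `x` falls in some block of the factorisation: `a` collects the complete blocks before
it and `c` is the part of that block already read. The first summand covers the empty factorisation.
-/
theorem leftQuotient_kstar (L : Language α) (x : List α) :
    (KStar.kstar L).leftQuotient x = sSup {M : Language α | x = [] ∧ M = KStar.kstar L} +
      sSup {M : Language α | ∃ a c, x = a ++ c ∧ a ∈ KStar.kstar L ∧ M = L.leftQuotient c} *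
        KStar.kstar L := by
  ext y
  rw [mem_leftQuotient, mem_add, mem_mul]
  constructor
  · rw [mem_kstar]
    rintro ⟨S, hS, hL⟩
    induction S generalizing x with
    | nil =>
      rw [List.flatten_nil, List.append_eq_nil_iff] at hS
      obtain ⟨rfl, rfl⟩ := hS
      exact .inl (Set.mem_sUnion.2 ⟨_, ⟨rfl, rfl⟩, nil_mem_kstar L⟩)
    | cons l S ih =>
      have hl : l ∈ L := hL l (by simp)
      have hS' : ∀ z ∈ S, z ∈ L := fun z hz => hL z (by simp [hz])
      rw [List.flatten_cons] at hS
      rcases List.append_eq_append_iff.1 hS with ⟨c, hx, hb'⟩ | ⟨c, hx, hy⟩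
      · right
        refine ⟨c, Set.mem_sUnion.2 ⟨L.leftQuotient x, ⟨[], x, rfl, nil_mem_kstar L, rfl⟩, ?_⟩,
          S.flatten, ⟨S, rfl, hS'⟩, hb'.symm⟩
        change x ++ c ∈ L
        rwa [← hx]
      · rcases ih c hy.symm hS' with h | ⟨u, hu, v, hv, rfl⟩
        · right
          obtain ⟨_, ⟨rfl, rfl⟩, h⟩ := Set.mem_sUnion.1 h
          -- Here `x` is exactly one block, so the unread part of that block is empty.
          refine ⟨[], Set.mem_sUnion.2 ⟨L.leftQuotient x, ⟨[], x, rfl, nil_mem_kstar L, rfl⟩, ?_⟩,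
            y, h, rfl⟩
          change x ++ [] ∈ L
          rw [hx]
          simpa using hl
        · right
          obtain ⟨_, ⟨a, c', rfl, ha, rfl⟩, hu⟩ := Set.mem_sUnion.1 hu
          refine ⟨u, Set.mem_sUnion.2 ⟨_, ⟨l ++ a, c', by rw [hx, List.append_assoc], ?_, rfl⟩, hu⟩,
            v, hv, rfl⟩
          obtain ⟨T, rfl, hT⟩ := ha
          exact ⟨l :: T, rfl, by simpa [hl] using hT⟩
  · rintro (h | ⟨u, hu, v, hv, rfl⟩)
    · obtain ⟨_, ⟨rfl, rfl⟩, h⟩ := Set.mem_sUnion.1 h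
      exact h
    · obtain ⟨_, ⟨a, c, rfl, ⟨T, rfl, hT⟩, rfl⟩, hu⟩ := Set.mem_sUnion.1 hu
      obtain ⟨S, rfl, hS⟩ := hv
      refine ⟨T ++ (c ++ u) :: S, by simp, ?_⟩
      intro z hz
      rcases List.mem_append.1 hz with hz | hz
      · exact hT z hz
      · rcases List.mem_cons.1 hz with rfl | hz
        · exact hu
        · exact hS z hz

/-- By the quotient formula, a quotient of the product is determined by a quotient of `L₁` and a set
of quotients of `L₂`, so there are finitely many. -/
theorem IsRegular.mul {L₁ L₂ : Language α} (h₁ : L₁.IsRegular) (h₂ : L₂.IsRegular) :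
    (L₁ * L₂).IsRegular := by
  refine IsRegular.of_finite_range_leftQuotient
    (((h₁.finite_range_leftQuotient.prod h₂.finite_range_leftQuotient.finite_subsets).image
      (fun p => p.1 * L₂ + sSup p.2)).subset ?_)
  rintro _ ⟨x, rfl⟩
  refine ⟨(L₁.leftQuotient x, _), ⟨⟨x, rfl⟩, ?_⟩, (leftQuotient_mul L₁ L₂ x).symm⟩
  rintro _ ⟨a, c, -, -, rfl⟩
  exact ⟨c, rfl⟩

theorem IsRegular.kstar {L : Language α} (h : L.IsRegular) : (KStar.kstar L).IsRegular := by
  refine IsRegular.of_finite_range_leftQuotient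
    ((((Set.finite_singleton (KStar.kstar L)).finite_subsets.prod
      h.finite_range_leftQuotient.finite_subsets).image
      (fun p => sSup p.1 + sSup p.2 * KStar.kstar L)).subset ?_)
  rintro _ ⟨x, rfl⟩
  refine ⟨({M | x = [] ∧ M = KStar.kstar L},
    {M | ∃ a c, x = a ++ c ∧ a ∈ KStar.kstar L ∧ M = L.leftQuotient c}), ⟨fun M h => h.2, ?_⟩,
    (leftQuotient_kstar L x).symm⟩
  rintro _ ⟨a, c, -, -, rfl⟩
  exact ⟨c, rfl⟩

end Language

/-! ### Guarded vector additions and their iteration -/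

/-- The relation "subtract `d`, which must be possible, then add `e`". -/
def VectorShift {ι : Type*} (d e s t : ι → ℕ) : Prop := ∃ r, s = r + d ∧ t = r + e

theorem VectorShift.comp_left {ι : Type*} (d d' e : ι → ℕ) :
    Relation.Comp (VectorShift d 0) (VectorShift d' e) = VectorShift (d' + d) e := by
  ext s t
  constructor
  · rintro ⟨u, ⟨r, rfl, rfl⟩, r', h, rfl⟩
    refine ⟨r', ?_, rfl⟩
    rw [add_zero] at h
    rw [h, add_assoc]
  · rintro ⟨r, rfl, rfl⟩
    exact ⟨r + d', ⟨r + d', by rw [add_assoc], by simp⟩, r, rfl, rfl⟩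

theorem VectorShift.comp_right {ι : Type*} (d e e' : ι → ℕ) :
    Relation.Comp (VectorShift d e) (VectorShift 0 e') = VectorShift d (e + e') := by
  ext s t
  constructor
  · rintro ⟨u, ⟨r, rfl, rfl⟩, r', h, rfl⟩
    refine ⟨r, rfl, ?_⟩
    rw [add_zero] at h
    rw [← h, add_assoc]
  · rintro ⟨r, rfl, rfl⟩
    exact ⟨r + e, ⟨r, rfl, rfl⟩, r + e, by simp, by rw [add_assoc]⟩

theorem VectorShift.zero_zero {ι : Type*} : VectorShift (0 : ι → ℕ) 0 = Eq := by
  ext s t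
  simp [VectorShift, eq_comm]

/-- Since `d` and `e` have disjoint supports, what one round adds cannot pay for what a later round
subtracts; so all subtractions can be done at the start. -/
theorem VectorShift.reflTransGen_iff {ι : Type*} {d e s t : ι → ℕ}
    (hde : ∀ i, d i = 0 ∨ e i = 0) :
    Relation.ReflTransGen (VectorShift d e) s t ↔ ∃ n : ℕ, VectorShift (n • d) (n • e) s t := by
  constructor
  · intro h
    induction h with
    | refl => exact ⟨0, s, by simp, by simp⟩
    | tail _ hbc ih =>
      obtain ⟨n, r, rfl, rfl⟩ := ih
      obtain ⟨r', h, rfl⟩ := hbc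
      have hd : d ≤ r := by
        intro i
        have := congrFun h i
        simp only [Pi.add_apply, Pi.smul_apply, smul_eq_mul] at this
        rcases hde i with h0 | h0
        · simp [h0]
        · rw [h0, mul_zero] at this
          change d i ≤ r i
          omega
      obtain ⟨q, rfl⟩ := exists_add_of_le hd
      refine ⟨n + 1, q, by rw [succ_nsmul]; abel, ?_⟩
      have : r' = q + n • e := by
        refine add_right_cancel (b := d) ?_
        rw [← h]
        abel
      rw [this, succ_nsmul]
      abel
  · rintro ⟨n, h⟩
    induction n generalizing t with
    | zero =>
      rw [zero_nsmul, zero_nsmul, VectorShift.zero_zero] at h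
      rw [h]
    | succ n ih =>
      obtain ⟨r, rfl, rfl⟩ := h
      refine .tail (ih (t := r + d + n • e) ⟨r + d, ?_, rfl⟩) ⟨r + n • e, by abel, ?_⟩ <;>
        rw [succ_nsmul] <;> abel

/-! ### Two-counter machines as regular languages of instructions -/

/-- The instructions of two-counter machines. -/
inductive CounterAction
  | inc (i : Fin 2)
  | dec (i : Fin 2)
  | test (i : Fin 2)

namespace CounterAction

instance : Finite CounterAction := by
  refine Finite.of_injective
    (fun a => match a with
      | inc i => ((0 : Fin 3), i)
      | dec i => ((1 : Fin 3), i)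
      | test i => ((2 : Fin 3), i)) ?_
  rintro (i | i | i) (j | j | j) h <;> simp_all

/-- The effect of an instruction on the counters; `test i` checks that the counter `i` is zero. -/
def Step : CounterAction → (Fin 2 → ℕ) → (Fin 2 → ℕ) → Prop
  | inc i, s, t => t = s + Pi.single i 1
  | dec i, s, t => s = t + Pi.single i 1
  | test i, s, t => s i = 0 ∧ t = s

/-- Execution of a sequence of instructions. -/
def Exec : List CounterAction → (Fin 2 → ℕ) → (Fin 2 → ℕ) → Prop
  | [], s, t => s = t
  | a :: w, s, t => ∃ u, a.Step s u ∧ Exec w u t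

theorem exec_append {u v : List CounterAction} {s t : Fin 2 → ℕ} :
    Exec (u ++ v) s t ↔ ∃ m, Exec u s m ∧ Exec v m t := by
  induction u generalizing s with
  | nil => simp [Exec]
  | cons a u ih =>
    simp only [List.cons_append, Exec, ih]
    constructor
    · rintro ⟨x, hx, m, h1, h2⟩
      exact ⟨m, ⟨x, hx, h1⟩, h2⟩
    · rintro ⟨m, ⟨x, hx, h1⟩, h2⟩
      exact ⟨x, hx, m, h1, h2⟩

/-- Relations on pairs of counters which are computed by two-counter machines. -/
def Definable (R : (Fin 2 → ℕ) → (Fin 2 → ℕ) → Prop) : Prop :=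
  ∃ L : Language CounterAction, L.IsRegular ∧ ∀ s t, R s t ↔ ∃ w ∈ L, Exec w s t

variable {R R' : (Fin 2 → ℕ) → (Fin 2 → ℕ) → Prop}

theorem Definable.step (a : CounterAction) : Definable a.Step :=
  ⟨{[a]}, .letter a, fun s t =>
    ⟨fun h => ⟨[a], rfl, t, h, rfl⟩, by rintro ⟨_, rfl, u, h, rfl⟩; exact h⟩⟩

theorem Definable.eq : Definable Eq :=
  ⟨1, .one, fun s t => ⟨fun h => ⟨[], Language.nil_mem_one, h⟩, by
    rintro ⟨w, hw, h⟩
    rw [Language.mem_one] at hw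
    subst hw
    exact h⟩⟩

theorem Definable.false : Definable (fun _ _ => False) :=
  ⟨0, .zero, fun _ _ => ⟨False.elim, fun ⟨w, hw, _⟩ => Language.notMem_zero w hw⟩⟩

/-- Concatenation of control languages realises composition of relations; below, sum realises union
and Kleene star realises iteration. Machines can thus be written as regular expressions. -/
theorem Definable.comp (h : Definable R) (h' : Definable R') :
    Definable (Relation.Comp R R') := by
  obtain ⟨L, hL, hR⟩ := h
  obtain ⟨L', hL', hR'⟩ := h'
  refine ⟨L * L', hL.mul hL', fun s t => ⟨?_, ?_⟩⟩
  · rintro ⟨u, h1, h2⟩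
    obtain ⟨w, hw, h1⟩ := (hR _ _).1 h1
    obtain ⟨w', hw', h2⟩ := (hR' _ _).1 h2
    exact ⟨w ++ w', Language.append_mem_mul hw hw', exec_append.2 ⟨u, h1, h2⟩⟩
  · rintro ⟨_, ⟨w, hw, w', hw', rfl⟩, h⟩
    obtain ⟨u, h1, h2⟩ := exec_append.1 h
    exact ⟨u, (hR _ _).2 ⟨w, hw, h1⟩, (hR' _ _).2 ⟨w', hw', h2⟩⟩

theorem Definable.union (h : Definable R) (h' : Definable R') :
    Definable (fun s t => R s t ∨ R' s t) := by
  obtain ⟨L, hL, hR⟩ := h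
  obtain ⟨L', hL', hR'⟩ := h'
  refine ⟨L + L', hL.add hL', fun s t => ?_⟩
  simp only [hR, hR', Language.mem_add, or_and_right, exists_or]

theorem Definable.star (h : Definable R) : Definable (Relation.ReflTransGen R) := by
  obtain ⟨L, hL, hR⟩ := h
  refine ⟨KStar.kstar L, hL.kstar, fun s t => ⟨fun h => ?_, ?_⟩⟩
  · induction h using Relation.ReflTransGen.head_induction_on with
    | refl => exact ⟨[], Language.nil_mem_kstar L, rfl⟩
    | head h1 _ ih =>
      obtain ⟨w, hw, h1⟩ := (hR _ _).1 h1
      obtain ⟨_, ⟨S, rfl, hS⟩, h2⟩ := ih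
      exact ⟨w ++ S.flatten, ⟨w :: S, rfl, by simpa [hw] using hS⟩, exec_append.2 ⟨_, h1, h2⟩⟩
  · rintro ⟨_, ⟨S, rfl, hS⟩, h⟩
    induction S generalizing s with
    | nil =>
      obtain rfl : s = t := h
      exact .refl
    | cons w S ih =>
      rw [List.flatten_cons] at h
      obtain ⟨u, h1, h2⟩ := exec_append.1 h
      exact .head ((hR _ _).2 ⟨w, hS w (by simp), h1⟩)
        (ih u (fun z hz => hS z (by simp [hz])) h2)

theorem Definable.exists_lt {R : ℕ → (Fin 2 → ℕ) → (Fin 2 → ℕ) → Prop}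
    (h : ∀ n, Definable (R n)) (m : ℕ) : Definable (fun s t => ∃ n < m, R n s t) := by
  induction m with
  | zero => simpa using Definable.false
  | succ m ih =>
    convert ih.union (h m) using 3
    constructor
    · rintro ⟨n, hn, h⟩
      rcases Nat.lt_succ_iff_lt_or_eq.1 hn with hn | rfl
      · exact .inl ⟨n, hn, h⟩
      · exact .inr h
    · rintro (⟨n, hn, h⟩ | h)
      · exact ⟨n, by omega, h⟩
      · exact ⟨m, by omega, h⟩

theorem Definable.dec (i : Fin 2) (n : ℕ) : Definable (VectorShift (Pi.single i n) 0) := by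
  induction n with
  | zero => rw [Pi.single_zero, VectorShift.zero_zero]; exact .eq
  | succ n ih =>
    rw [Pi.single_add, ← VectorShift.comp_left]
    refine Definable.comp ?_ ih
    convert Definable.step (CounterAction.dec i) using 1
    ext s t
    constructor
    · rintro ⟨r, rfl, rfl⟩
      simp [Step]
    · intro h
      exact ⟨t, h, by simp⟩

theorem Definable.inc (i : Fin 2) (n : ℕ) : Definable (VectorShift 0 (Pi.single i n)) := by
  induction n with
  | zero => rw [Pi.single_zero, VectorShift.zero_zero]; exact .eq
  | succ n ih =>
    rw [Pi.single_add, ← VectorShift.comp_right]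
    refine Definable.comp ih ?_
    convert Definable.step (CounterAction.inc i) using 1
    ext s t
    constructor
    · rintro ⟨r, rfl, rfl⟩
      simp [Step]
    · intro h
      exact ⟨s, by simp, h⟩

/-- Repeatedly subtract `c` from the counter `i` and add `d` to the other counter `j`. -/
theorem Definable.transfer {i j : Fin 2} (hij : i ≠ j) (c d : ℕ) :
    Definable (fun s t => ∃ n, VectorShift (Pi.single i (n * c)) (Pi.single j (n * d)) s t) := by
  have h := ((Definable.dec i c).comp (Definable.inc j d)).star
  rw [VectorShift.comp_right, zero_add] at h
  convert h using 3
  rw [VectorShift.reflTransGen_iff]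
  · simp only [← Pi.single_smul, smul_eq_mul]
  · intro l
    by_cases hl : l = i
    · subst hl
      right
      simp [hij]
    · left
      simp [hl]

theorem vectorShift_zero_one {c d a b a' b' : ℕ} :
    VectorShift (Pi.single (0 : Fin 2) c) (Pi.single 1 d) ![a, b] ![a', b'] ↔
      a = a' + c ∧ b' = b + d := by
  constructor
  · rintro ⟨r, h, h'⟩
    have h0 := congrFun h 0
    have h1 := congrFun h 1
    have h0' := congrFun h' 0
    have h1' := congrFun h' 1
    simp at h0 h1 h0' h1'
    omega
  · rintro ⟨rfl, rfl⟩
    refine ⟨![a', b], ?_, ?_⟩ <;> ext l <;> fin_cases l <;> simp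

theorem vectorShift_one_zero {c d a b a' b' : ℕ} :
    VectorShift (Pi.single (1 : Fin 2) c) (Pi.single 0 d) ![a, b] ![a', b'] ↔
      a' = a + d ∧ b = b' + c := by
  constructor
  · rintro ⟨r, h, h'⟩
    have h0 := congrFun h 0
    have h1 := congrFun h 1
    have h0' := congrFun h' 0
    have h1' := congrFun h' 1
    simp at h0 h1 h0' h1'
    omega
  · rintro ⟨rfl, rfl⟩
    refine ⟨![a, b'], ?_, ?_⟩ <;> ext l <;> fin_cases l <;> simp

theorem exists_eq_pair (t : Fin 2 → ℕ) : ∃ a b, t = ![a, b] :=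
  ⟨t 0, t 1, by ext l; fin_cases l <;> rfl⟩

/-- Replace the value `n * c` of the first counter by `n * d`, using the second counter. -/
theorem Definable.scale {c d : ℕ} :
    ∃ R, Definable R ∧ ∀ N t, R ![N, 0] t ↔ ∃ n, N = n * c ∧ t = ![n * d, 0] := by
  -- The number of rounds of each transfer is guessed; the zero test after it rejects every guess
  -- that leaves the source counter nonempty.
  refine ⟨_, (((Definable.transfer zero_ne_one c d).comp (.step (.test 0))).comp
    (Definable.transfer one_ne_zero 1 1)).comp (.step (.test 1)), fun N t => ?_⟩
  constructor
  · rintro ⟨_, ⟨u, ⟨_, ⟨n, h1⟩, h2, rfl⟩, m, h3⟩, h4, rfl⟩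
    obtain ⟨a, b, rfl⟩ := exists_eq_pair u
    obtain ⟨a', b', rfl⟩ := exists_eq_pair t
    rw [vectorShift_zero_one] at h1
    rw [vectorShift_one_zero] at h3
    simp at h2 h4
    obtain ⟨rfl, rfl⟩ := h1
    obtain ⟨rfl, h3⟩ := h3
    refine ⟨n, by omega, ?_⟩
    congr 1
    · omega
    · simp [h4]
  · rintro ⟨n, rfl, rfl⟩
    refine ⟨_, ⟨![0, n * d], ⟨_, ⟨n, vectorShift_zero_one.2 ⟨by simp, by simp⟩⟩, rfl, rfl⟩, n * d,
      vectorShift_one_zero.2 ⟨?_, ?_⟩⟩, rfl, rfl⟩ <;> simp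

/-- Multiples of `p` are moved to the second counter, then a guessed remainder between `1` and `p -
1` must empty the first counter. Everything is finally moved back, so the value is preserved. -/
theorem Definable.not_dvd {p : ℕ} (hp : 0 < p) :
    ∃ R, Definable R ∧ ∀ N t, R ![N, 0] t ↔ ¬ p ∣ N ∧ t = ![N, 0] := by
  refine ⟨_, (((Definable.transfer zero_ne_one p p).comp (Definable.exists_lt (fun n =>
    ((Definable.dec 0 (n + 1)).comp (.step (.test 0))).comp
    (Definable.inc 1 (n + 1))) (p - 1))).comp
    (Definable.transfer one_ne_zero 1 1)).comp ((Definable.step (.test 1))), fun N t => ?_⟩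
  constructor
  · rintro ⟨_, ⟨v, ⟨u, ⟨n, h1⟩, r, hr, ⟨u', ⟨u'', h5, h6, rfl⟩, h7⟩⟩, m, h3⟩, h4, rfl⟩
    obtain ⟨a, b, rfl⟩ := exists_eq_pair u
    obtain ⟨a', b', rfl⟩ := exists_eq_pair t
    obtain ⟨a'', b'', rfl⟩ := exists_eq_pair v
    obtain ⟨x, y, rfl⟩ := exists_eq_pair u'
    rw [vectorShift_zero_one] at h1
    rw [vectorShift_one_zero] at h3
    rw [← Pi.single_zero 1, vectorShift_zero_one] at h5
    rw [← Pi.single_zero 0, vectorShift_zero_one] at h7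
    simp at h6 h4
    obtain ⟨rfl, rfl⟩ := h1
    obtain ⟨rfl, h3⟩ := h3
    obtain ⟨rfl, rfl⟩ := h5
    obtain ⟨rfl, rfl⟩ := h7
    subst h6 h4
    constructor
    · rw [← Nat.dvd_add_iff_left (Nat.dvd_mul_left p n)]
      intro h
      have := Nat.le_of_dvd (by omega) h
      omega
    · congr 1
      omega
  · rintro ⟨h, rfl⟩
    have h1 := Nat.div_add_mod N p
    have h2 : N % p ≠ 0 := fun h0 => h (Nat.dvd_of_mod_eq_zero h0)
    have h3 := Nat.mod_lt N hp
    rw [mul_comm] at h1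
    refine ⟨_, ⟨![0, N], ⟨![N % p, N / p * p], ⟨N / p, vectorShift_zero_one.2 ⟨by omega, by simp⟩⟩,
      N % p - 1, by omega, ![0, N / p * p], ⟨![0, N / p * p], ?_, rfl, rfl⟩, ?_⟩, N,
      vectorShift_one_zero.2 ⟨?_, ?_⟩⟩, rfl, rfl⟩
    · rw [← Pi.single_zero 1, vectorShift_zero_one]
      omega
    · rw [← Pi.single_zero 0, vectorShift_zero_one]
      omega
    · simp
    · simp

end CounterAction

/-! ### Register programs and their simulation by prime exponents -/

/-- Relations on the values of `k` registers which are computed by nondeterministic register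
programs; such programs may use further registers, which are zero before and after. -/
inductive RegisterRel : ∀ k : ℕ, ((Fin k → ℕ) → (Fin k → ℕ) → Prop) → Prop
  | inc {k : ℕ} (i : Fin k) : RegisterRel k (fun v w => w = v + Pi.single i 1)
  | dec {k : ℕ} (i : Fin k) : RegisterRel k (fun v w => v = w + Pi.single i 1)
  | zero {k : ℕ} (i : Fin k) : RegisterRel k (fun v w => v i = 0 ∧ w = v)
  | eq (k : ℕ) : RegisterRel k Eq
  | comp {k : ℕ} {R R' : (Fin k → ℕ) → (Fin k → ℕ) → Prop} :
      RegisterRel k R → RegisterRel k R' → RegisterRel k (Relation.Comp R R')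
  | union {k : ℕ} {R R' : (Fin k → ℕ) → (Fin k → ℕ) → Prop} :
      RegisterRel k R → RegisterRel k R' → RegisterRel k (fun v w => R v w ∨ R' v w)
  | star {k : ℕ} {R : (Fin k → ℕ) → (Fin k → ℕ) → Prop} :
      RegisterRel k R → RegisterRel k (Relation.ReflTransGen R)
  | hide {k : ℕ} {R : (Fin (k + 1) → ℕ) → (Fin (k + 1) → ℕ) → Prop} :
      RegisterRel (k + 1) R → RegisterRel k (fun v w => R (Fin.cons 0 v) (Fin.cons 0 w))

/-- The encoding of register values by a product of prime powers. -/
def primeCode {k : ℕ} (p v : Fin k → ℕ) : ℕ := ∏ i, p i ^ v i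

theorem primeCode_add_single {k : ℕ} (p v : Fin k → ℕ) (i : Fin k) :
    primeCode p (v + Pi.single i 1) = primeCode p v * p i := by
  simp only [primeCode, Pi.add_apply, pow_add, Finset.prod_mul_distrib]
  congr 1
  rw [Finset.prod_eq_single i]
  · simp
  · intro j _ hj
    simp [hj]
  · simp

theorem primeCode_cons_zero {k : ℕ} (p v : Fin k → ℕ) (q : ℕ) :
    primeCode (Fin.cons q p : Fin (k + 1) → ℕ) (Fin.cons 0 v) = primeCode p v := by
  simp [primeCode, Fin.prod_univ_succ]

theorem dvd_primeCode_iff {k : ℕ} {p : Fin k → ℕ} (hp : ∀ i, (p i).Prime)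
    (hinj : Function.Injective p) (v : Fin k → ℕ) (i : Fin k) :
    p i ∣ primeCode p v ↔ v i ≠ 0 := by
  rw [primeCode, (hp i).prime.dvd_finsetProd_iff]
  constructor
  · rintro ⟨j, -, hj⟩
    have h := (Nat.prime_dvd_prime_iff_eq (hp i) (hp j)).1 ((hp i).dvd_of_dvd_pow hj)
    rw [hinj h]
    rintro h0
    rw [h0, pow_zero] at hj
    exact (hp i).one_lt.ne' (Nat.dvd_one.1 hj)
  · intro h
    exact ⟨i, Finset.mem_univ i, dvd_pow_self _ h⟩

/-- Every register program is simulated by a two-counter machine. -/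
theorem RegisterRel.exists_definable {k : ℕ} {R : (Fin k → ℕ) → (Fin k → ℕ) → Prop}
    (h : RegisterRel k R) (p : Fin k → ℕ) (hp : ∀ i, (p i).Prime) (hinj : Function.Injective p) :
    ∃ R', CounterAction.Definable R' ∧ ∀ v t, R' ![primeCode p v, 0] t ↔
      ∃ w, t = ![primeCode p w, 0] ∧ R v w := by
  -- Incrementing, decrementing and zero-testing the register `i` become multiplication by `p i`,
  -- exact division by `p i`, and the test that `p i` does not divide the code.
  induction h with
  | inc i =>
    obtain ⟨R', hR', h⟩ := CounterAction.Definable.scale (c := 1) (d := p i)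
    refine ⟨R', hR', fun v t => (h _ _).trans ?_⟩
    simp [primeCode_add_single]
  | dec i =>
    obtain ⟨R', hR', h⟩ := CounterAction.Definable.scale (c := p i) (d := 1)
    refine ⟨R', hR', fun v t => (h _ _).trans ⟨?_, ?_⟩⟩
    · rintro ⟨n, hn, rfl⟩
      have h0 : v i ≠ 0 := (dvd_primeCode_iff hp hinj v i).1 ⟨n, by rw [hn, mul_comm]⟩
      have hv : v = (v - Pi.single i 1) + Pi.single i 1 := by
        ext j
        by_cases hj : j = i
        · subst hj
          simp
          omega
        · simp [hj]
      refine ⟨v - Pi.single i 1, ?_, hv⟩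
      rw [hv, primeCode_add_single] at hn
      rw [Nat.eq_of_mul_eq_mul_right (hp i).pos hn, mul_one]
    · rintro ⟨w, rfl, rfl⟩
      exact ⟨primeCode p w, primeCode_add_single p w i, by rw [mul_one]⟩
  | zero i =>
    obtain ⟨R', hR', h⟩ := CounterAction.Definable.not_dvd (hp i).pos
    refine ⟨R', hR', fun v t => (h _ _).trans ?_⟩
    rw [dvd_primeCode_iff hp hinj, not_not]
    constructor
    · rintro ⟨h0, rfl⟩
      exact ⟨v, rfl, h0, rfl⟩
    · rintro ⟨w, rfl, h0, rfl⟩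
      exact ⟨h0, rfl⟩
  | eq k =>
    refine ⟨Eq, .eq, fun v t => ⟨?_, ?_⟩⟩
    · rintro rfl
      exact ⟨v, rfl, rfl⟩
    · rintro ⟨w, rfl, rfl⟩
      rfl
  | comp _ _ ih ih' =>
    obtain ⟨S, hS, h⟩ := ih p hp hinj
    obtain ⟨S', hS', h'⟩ := ih' p hp hinj
    refine ⟨_, hS.comp hS', fun v t => ⟨?_, ?_⟩⟩
    · rintro ⟨u, h1, h2⟩
      obtain ⟨x, rfl, hx⟩ := (h _ _).1 h1
      obtain ⟨w, rfl, hw⟩ := (h' _ _).1 h2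
      exact ⟨w, rfl, x, hx, hw⟩
    · rintro ⟨w, rfl, x, h1, h2⟩
      exact ⟨_, (h _ _).2 ⟨x, rfl, h1⟩, (h' _ _).2 ⟨w, rfl, h2⟩⟩
  | union _ _ ih ih' =>
    obtain ⟨S, hS, h⟩ := ih p hp hinj
    obtain ⟨S', hS', h'⟩ := ih' p hp hinj
    refine ⟨_, hS.union hS', fun v t => ?_⟩
    rw [h, h', ← exists_or]
    simp only [and_or_left]
  | star _ ih =>
    obtain ⟨S, hS, h⟩ := ih p hp hinj
    refine ⟨_, hS.star, fun v t => ⟨fun h1 => ?_, ?_⟩⟩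
    · induction h1 with
      | refl => exact ⟨v, rfl, .refl⟩
      | tail _ h2 ih =>
        obtain ⟨x, rfl, h3⟩ := ih
        obtain ⟨w, rfl, hw⟩ := (h _ _).1 h2
        exact ⟨w, rfl, h3.tail hw⟩
    · rintro ⟨w, rfl, h1⟩
      exact h1.lift (fun w => ![primeCode p w, 0]) (fun a b hab => (h _ _).2 ⟨b, rfl, hab⟩)
  | @hide k R _ ih =>
    -- The extra register needs a fresh prime; one above the sum of all `p i` differs from each of
    -- them.
    obtain ⟨q, hq, hqp⟩ := Nat.exists_infinite_primes (∑ i, p i + 1)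
    have hq' : ∀ i, p i ≠ q := fun i => by
      have := Finset.single_le_sum (f := p) (fun _ _ => Nat.zero_le _) (Finset.mem_univ i)
      omega
    have hp' : ∀ i, ((Fin.cons q p : Fin (k + 1) → ℕ) i).Prime := by
      intro i
      refine Fin.cases ?_ (fun i => ?_) i
      · simpa using hqp
      · simpa using hp i
    have hinj' : Function.Injective (Fin.cons q p : Fin (k + 1) → ℕ) :=
      Fin.cons_injective_iff.2 ⟨fun ⟨i, hi⟩ => hq' i hi, hinj⟩
    obtain ⟨S, hS, h⟩ := ih (Fin.cons q p) hp' hinj'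
    obtain ⟨Z, hZ, hz⟩ := CounterAction.Definable.not_dvd hqp.pos
    have hzero (w : Fin (k + 1) → ℕ) : ¬ q ∣ primeCode (Fin.cons q p) w ↔ w 0 = 0 := by
      have := dvd_primeCode_iff hp' hinj' w 0
      rw [Fin.cons_zero] at this
      rw [this, not_not]
    -- The extra register is zero at the start because `q` contributes exponent `0`; that it is zero
    -- again at the end is enforced by testing indivisibility by `q`.
    refine ⟨_, hS.comp hZ, fun v t => ⟨?_, ?_⟩⟩
    · rintro ⟨u, h1, h2⟩
      rw [← primeCode_cons_zero p v q] at h1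
      obtain ⟨x, rfl, hx1⟩ := (h _ _).1 h1
      obtain ⟨h0, rfl⟩ := (hz _ _).1 h2
      rw [hzero] at h0
      have hx : x = Fin.cons 0 (Fin.tail x) := by rw [← h0, Fin.cons_self_tail]
      rw [hx] at hx1 ⊢
      exact ⟨Fin.tail x, by rw [primeCode_cons_zero], hx1⟩
    · rintro ⟨w, rfl, h1⟩
      have h2 := (h (Fin.cons 0 v) _).2 ⟨Fin.cons 0 w, rfl, h1⟩
      rw [primeCode_cons_zero] at h2
      exact ⟨_, h2, (hz _ _).2 ⟨(hzero (Fin.cons 0 w)).2 rfl, by rw [primeCode_cons_zero]⟩⟩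

/-! ### Programming with registers: existential guesses, iteration, primitive recursion -/

namespace RegisterRel

variable {k : ℕ} {R R' : (Fin k → ℕ) → (Fin k → ℕ) → Prop}

theorem congr (h : RegisterRel k R) (e : ∀ v w, R' v w ↔ R v w) : RegisterRel k R' := by
  have : R' = R := by
    ext v w
    exact e v w
  rwa [this]

/-- Assign an arbitrary value to a register. -/
theorem havoc (i : Fin k) : RegisterRel k (fun v w => ∃ y, w = Function.update v i y) := by
  -- Decrement arbitrarily often, then increment arbitrarily often; any value is reached by going
  -- through `0`.
  refine ((RegisterRel.dec i).star.comp (RegisterRel.inc i).star).congr fun v w => ⟨?_, ?_⟩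
  · rintro ⟨y, rfl⟩
    refine ⟨Function.update v i 0, ?_, ?_⟩
    · generalize hn : v i = n
      induction n generalizing v with
      | zero => rw [← hn, Function.update_eq_self]
      | succ n ih =>
        have := ih (Function.update v i n) (by simp)
        rw [Function.update_idem] at this
        refine .head (?_ : v = _) this
        ext j
        by_cases hj : j = i
        · subst hj; simp [hn]
        · simp [hj]
    · induction y with
      | zero => exact .refl
      | succ y ih =>
        refine ih.tail ?_
        ext j
        by_cases hj : j = i
        · subst hj; simp
        · simp [hj]
  · have aux : ∀ {S : (Fin k → ℕ) → (Fin k → ℕ) → Prop},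
        (∀ v w, S v w → ∀ j ≠ i, w j = v j) → ∀ v w, Relation.ReflTransGen S v w →
          ∀ j ≠ i, w j = v j := by
      intro S hS v w h
      induction h with
      | refl => exact fun _ _ => rfl
      | tail _ h ih => exact fun j hj => (hS _ _ h j hj).trans (ih j hj)
    rintro ⟨u, h1, h2⟩
    have h1 := aux (fun v w h j hj => by subst h; simp [hj]) _ _ h1
    have h2 := aux (fun v w h j hj => by subst h; simp [hj]) _ _ h2
    refine ⟨w i, ?_⟩
    ext j
    by_cases hj : j = i
    · subst hj; simp
    · simp [hj, h1 j hj, h2 j hj]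

/-- A hidden register must start and end at zero; guessing its value before `R` and overwriting it
with a guess afterwards removes both constraints. -/
theorem exists_cons {R : (Fin (k + 1) → ℕ) → (Fin (k + 1) → ℕ) → Prop}
    (h : RegisterRel (k + 1) R) :
    RegisterRel k (fun v w => ∃ a b : ℕ, R (Fin.cons a v) (Fin.cons b w)) := by
  refine (((havoc 0).comp h).comp (havoc 0)).hide.congr fun v w => ⟨?_, ?_⟩
  · rintro ⟨a, b, h⟩
    exact ⟨_, ⟨_, ⟨a, by rw [Fin.update_cons_zero]⟩, h⟩, 0, by rw [Fin.update_cons_zero]⟩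
  · rintro ⟨u, ⟨_, ⟨a, rfl⟩, h⟩, b, hb⟩
    rw [Fin.update_cons_zero] at h
    refine ⟨a, u 0, ?_⟩
    have hu : u = Fin.cons (u 0) w := by
      rw [← Fin.cons_self_tail u, Fin.update_cons_zero] at hb
      rw [(Fin.cons_inj.1 hb).2, Fin.cons_self_tail]
    rwa [← hu]

end RegisterRel

/-- Predicates on the values of registers which are tested by nondeterministic register
programs. -/
def Testable (k : ℕ) (P : (Fin k → ℕ) → Prop) : Prop :=
  RegisterRel k (fun v w => P v ∧ w = v)

namespace Testable

variable {k : ℕ} {P Q : (Fin k → ℕ) → Prop}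

theorem congr (h : Testable k P) (e : ∀ v, Q v ↔ P v) : Testable k Q :=
  RegisterRel.congr h fun v w => by rw [e]

theorem before {R : (Fin k → ℕ) → (Fin k → ℕ) → Prop} (h : Testable k P) (hR : RegisterRel k R) :
    RegisterRel k (fun v w => P v ∧ R v w) :=
  (RegisterRel.comp h hR).congr fun v w =>
    ⟨fun ⟨h1, h2⟩ => ⟨v, ⟨h1, rfl⟩, h2⟩, by rintro ⟨_, ⟨h1, rfl⟩, h2⟩; exact ⟨h1, h2⟩⟩

theorem after {R : (Fin k → ℕ) → (Fin k → ℕ) → Prop} (h : Testable k P) (hR : RegisterRel k R) :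
    RegisterRel k (fun v w => R v w ∧ P w) :=
  (RegisterRel.comp hR h).congr fun v w =>
    ⟨fun ⟨h1, h2⟩ => ⟨w, h1, h2, rfl⟩, by rintro ⟨_, h1, h2, rfl⟩; exact ⟨h1, h2⟩⟩

theorem and (hP : Testable k P) (hQ : Testable k Q) : Testable k (fun v => P v ∧ Q v) :=
  (hP.before hQ).congr fun _ _ => and_assoc

theorem or (hP : Testable k P) (hQ : Testable k Q) : Testable k (fun v => P v ∨ Q v) :=
  (RegisterRel.union hP hQ).congr fun _ _ => or_and_right

theorem ex {P : (Fin k → ℕ) → ℕ → Prop}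
    (h : Testable (k + 1) (fun x => P (fun i => x i.succ) (x 0))) :
    Testable k (fun v => ∃ y, P v y) := by
  refine (RegisterRel.exists_cons h).congr fun v w => ⟨?_, ?_⟩
  · rintro ⟨⟨y, hy⟩, rfl⟩
    exact ⟨y, y, by simpa using hy, rfl⟩
  · rintro ⟨a, b, h1, h2⟩
    exact ⟨⟨a, by simpa using h1⟩, (Fin.cons_inj.1 h2).2⟩

theorem eq_zero (i : Fin k) : Testable k (fun v => v i = 0) := .zero i

/-- Both registers are drained in lockstep into a hidden one, tested for zero together, and refilled
from it. -/
theorem eq_of_ne {i j : Fin k} (hij : i ≠ j) : Testable k (fun v => v i = v j) := by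
  have down : RegisterRel (k + 1) (VectorShift
      (Pi.single i.succ 1 + Pi.single j.succ 1) (Pi.single 0 1)) := by
    refine (((RegisterRel.dec j.succ).comp (.dec i.succ)).comp (.inc 0)).congr fun v w => ⟨?_, ?_⟩
    · rintro ⟨r, rfl, rfl⟩
      exact ⟨_, ⟨_, add_assoc _ _ _ |>.symm, rfl⟩, rfl⟩
    · rintro ⟨r, ⟨_, rfl, rfl⟩, rfl⟩
      exact ⟨r, add_assoc _ _ _, rfl⟩
  have up : RegisterRel (k + 1) (VectorShift
      (Pi.single 0 1) (Pi.single i.succ 1 + Pi.single j.succ 1)) := by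
    refine (((RegisterRel.dec 0).comp (.inc i.succ)).comp (.inc j.succ)).congr fun v w => ⟨?_, ?_⟩
    · rintro ⟨r, rfl, rfl⟩
      exact ⟨_, ⟨_, rfl, rfl⟩, add_assoc _ _ _ |>.symm⟩
    · rintro ⟨_, ⟨r, rfl, rfl⟩, rfl⟩
      exact ⟨r, rfl, add_assoc _ _ _⟩
  have hne (l : Fin (k + 1)) : (Pi.single i.succ 1 + Pi.single j.succ 1 : Fin (k + 1) → ℕ) l = 0 ∨
      (Pi.single 0 1 : Fin (k + 1) → ℕ) l = 0 := by
    by_cases hl : l = 0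
    · subst hl
      left
      simp [(Fin.succ_ne_zero _).symm]
    · right
      simp [hl]
  refine ((((down.star.comp (.zero i.succ)).comp (.zero j.succ)).comp up.star)).hide.congr
    fun v w => ⟨?_, ?_⟩
  · rintro ⟨h, rfl⟩
    set r : Fin (k + 1) → ℕ := Fin.cons 0 (fun l => if l = i ∨ l = j then 0 else w l) with hr
    have hv : (Fin.cons 0 w : Fin (k + 1) → ℕ) =
        r + w i • (Pi.single i.succ 1 + Pi.single j.succ 1) := by
      ext l
      refine Fin.cases ?_ (fun l => ?_) l
      · simp [hr, (Fin.succ_ne_zero _).symm]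
      · by_cases hi : l = i
        · subst hi
          simp [hr, hij]
        · by_cases hj : l = j
          · subst hj
            simp [hr, hi, h]
          · simp [hr, hi, hj]
    refine ⟨r + w i • Pi.single 0 1, ⟨_, ⟨_, (VectorShift.reflTransGen_iff hne).2
      ⟨w i, r, hv, rfl⟩, ?_, rfl⟩, ?_, rfl⟩,
      (VectorShift.reflTransGen_iff fun l => (hne l).symm).2 ⟨w i, r, rfl, hv⟩⟩
    · simp [hr, Fin.succ_ne_zero]
    · simp [hr, Fin.succ_ne_zero]
  · rintro ⟨_, ⟨_, ⟨u, h1, hi, rfl⟩, hj, rfl⟩, h2⟩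
    obtain ⟨n, r, hv, rfl⟩ := (VectorShift.reflTransGen_iff hne).1 h1
    obtain ⟨m, r', hu, hw⟩ := (VectorShift.reflTransGen_iff fun l => (hne l).symm).1 h2
    have e0 := congrFun hv 0
    have e1 := congrFun hv i.succ
    have e2 := congrFun hv j.succ
    have e3 := congrFun hu 0
    have e4 := congrFun hw 0
    simp [Fin.succ_ne_zero, (Fin.succ_ne_zero _).symm, hij, hij.symm]
      at e0 e1 e2 e3 e4 hi hj
    -- The hidden register is zero at both ends, so as many rounds refill as drained.
    have hnm : n = m := by omega
    subst hnm
    refine ⟨by omega, ?_⟩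
    rw [← add_right_cancel hu, ← hv] at hw
    exact (Fin.cons_inj.1 hw).2

theorem eq (i j : Fin k) : Testable k (fun v => v i = v j) := by
  by_cases hij : i = j
  · subst hij
    exact RegisterRel.congr (.eq k) fun v w => by simp [eq_comm]
  · exact eq_of_ne hij

theorem eq_succ (i j : Fin k) : Testable k (fun v => v j = v i + 1) := by
  refine (RegisterRel.exists_cons ((eq 0 j.succ).before ((eq 0 i.succ).after (.dec 0)))).congr
    fun v w => ⟨?_, ?_⟩
  · rintro ⟨h, rfl⟩
    refine ⟨w j, w i, by simp, ?_, by simp⟩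
    ext l
    refine Fin.cases ?_ (fun l => ?_) l
    · simp [h]
    · simp [Fin.succ_ne_zero]
  · rintro ⟨a, b, h1, h2, h3⟩
    have e := congrFun h2 0
    have : v = w := by
      ext l
      have := congrFun h2 l.succ
      simpa [Fin.succ_ne_zero] using this
    simp at h1 h3 e
    subst this
    exact ⟨by omega, rfl⟩

/-- Assign the value of the register `j` to the register `i`. -/
theorem assign {i j : Fin k} (hij : j ≠ i) :
    RegisterRel k (fun v w => w = Function.update v i (v j)) := by
  refine ((eq i j).after (RegisterRel.havoc i)).congr fun v w => ⟨?_, ?_⟩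
  · rintro rfl
    exact ⟨⟨_, rfl⟩, by simp [hij]⟩
  · rintro ⟨⟨y, rfl⟩, h⟩
    simp [hij] at h
    rw [h]

/-- Transitive closures of testable relations on pairs are testable. -/
theorem reflTransGen {P : (Fin k → ℕ) → ℕ × ℕ → ℕ × ℕ → Prop}
    (h : Testable (k + 4) (fun x => P (fun i => x i.succ.succ.succ.succ) (x 2, x 3) (x 0, x 1)))
    (a b c d : Fin k) :
    Testable k (fun v => Relation.ReflTransGen (P v) (v a, v b) (v c, v d)) := by
  -- One iteration: the current pair sits in registers `0` and `1`. Two further registers receive a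
  -- guessed successor pair, `P` is tested, and the guess is copied over the current pair.
  have body : RegisterRel (k + 2) (fun x y =>
      P (fun i => x i.succ.succ) (x 0, x 1) (y 0, y 1) ∧
        ∀ i : Fin k, y i.succ.succ = x i.succ.succ) := by
    have h2 (p q z : ℕ) (x : Fin (k + 2) → ℕ) :
        Function.update (Fin.cons p (Fin.cons q x : Fin (k + 3) → ℕ) : Fin (k + 4) → ℕ) 2 z =
          Fin.cons p (Fin.cons q (Function.update x 0 z) : Fin (k + 3) → ℕ) := by
      rw [Fin.cons_update, Fin.cons_update]
      rfl
    have h3 (p q z : ℕ) (x : Fin (k + 2) → ℕ) :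
        Function.update (Fin.cons p (Fin.cons q x : Fin (k + 3) → ℕ) : Fin (k + 4) → ℕ) 3 z =
          Fin.cons p (Fin.cons q (Function.update x 1 z) : Fin (k + 3) → ℕ) := by
      rw [Fin.cons_update, Fin.cons_update]
      rfl
    refine (h.before ((assign (i := 2) (j := 0) (Fin.succ_ne_zero (1 : Fin (k + 3))).symm).comp
      (assign (i := 3) (j := 1) ((Fin.succ_injective _).ne
        (Fin.succ_ne_zero (1 : Fin (k + 2))).symm)))).exists_cons.exists_cons.congr
      fun x y => ⟨?_, ?_⟩
    · rintro ⟨hP, hy⟩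
      -- The outer `exists_cons` introduces register `1` and the inner one register `0`, hence this
      -- order.
      refine ⟨y 1, y 1, y 0, y 0, hP, _, rfl, ?_⟩
      beta_reduce
      rw [h2, h3]
      congr 2
      ext i
      refine Fin.cases ?_ (fun i => Fin.cases ?_ (fun i => ?_) i) i
      · simp
      · simp
      · rw [hy, Function.update_of_ne, Function.update_of_ne]
        · exact Fin.succ_ne_zero _
        · exact (Fin.succ_injective _).ne (Fin.succ_ne_zero _)
    · rintro ⟨p, p', q, q', hP, _, rfl, hy⟩
      rw [h2, h3] at hy
      obtain ⟨rfl, hy⟩ := Fin.cons_inj.1 hy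
      obtain ⟨rfl, rfl⟩ := Fin.cons_inj.1 hy
      refine ⟨?_, fun i => ?_⟩
      · change P _ (x 0, x 1) (Function.update (Function.update x 0 q') 1 p' 0,
          Function.update (Function.update x 0 q') 1 p' 1)
        change P (fun i => x i.succ.succ) (x 0, x 1) (q', p') at hP
        simpa using hP
      · rw [Function.update_of_ne, Function.update_of_ne]
        · exact Fin.succ_ne_zero _
        · exact (Fin.succ_injective _).ne (Fin.succ_ne_zero _)
  refine ((((eq 0 a.succ.succ).and (eq 1 b.succ.succ)).before
    (((eq 0 c.succ.succ).and (eq 1 d.succ.succ)).after body.star))).exists_cons.exists_cons.congr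
    fun v w => ⟨?_, ?_⟩
  · rintro ⟨h, rfl⟩
    refine ⟨w b, w d, w a, w c, ⟨rfl, rfl⟩, ?_, rfl, rfl⟩
    have := h.lift (p := fun x y : Fin (k + 2) → ℕ =>
        P (fun i => x i.succ.succ) (x 0, x 1) (y 0, y 1) ∧
          ∀ i : Fin k, y i.succ.succ = x i.succ.succ)
      (fun p : ℕ × ℕ => (Fin.cons p.1 (Fin.cons p.2 w : Fin (k + 1) → ℕ) : Fin (k + 2) → ℕ))
      (fun p q hpq => ⟨hpq, fun i => rfl⟩)
    exact this
  · rintro ⟨p, q, p', q', ⟨h0, h1⟩, h, h2, h3⟩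
    have aux : ∀ X Y : Fin (k + 2) → ℕ, Relation.ReflTransGen (fun x y : Fin (k + 2) → ℕ =>
        P (fun i => x i.succ.succ) (x 0, x 1) (y 0, y 1) ∧
          ∀ i : Fin k, y i.succ.succ = x i.succ.succ) X Y →
        (fun i : Fin k => Y i.succ.succ) = (fun i => X i.succ.succ) ∧
          Relation.ReflTransGen (P fun i => X i.succ.succ) (X 0, X 1) (Y 0, Y 1) := by
      intro X Y hXY
      induction hXY with
      | refl => exact ⟨rfl, .refl⟩
      | tail _ hbc ih =>
        rw [ih.1] at hbc
        exact ⟨(funext hbc.2).trans ih.1, ih.2.tail hbc.1⟩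
    obtain ⟨hw, h⟩ := aux _ _ h
    obtain rfl : w = v := hw
    refine ⟨?_, rfl⟩
    change p' = w a at h0
    change p = w b at h1
    change q' = w c at h2
    change q = w d at h3
    rw [← h0, ← h1, ← h2, ← h3]
    exact h

/-- Primitive recursion preserves testability of graphs. -/
theorem rec_eq {F : (Fin k → ℕ) → ℕ → ℕ → ℕ}
    (h : Testable (k + 5) (fun x => x 1 = F (fun i => x i.succ.succ.succ.succ.succ) (x 2) (x 3)))
    (a n r : Fin k) :
    Testable k (fun v => v r = Nat.rec (v a) (F v) (v n)) := by
  -- The recursion is run as an iteration on pairs (index, value) starting from `(0, v a)`.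
  have key (v : Fin k → ℕ) (p : ℕ × ℕ) : Relation.ReflTransGen
      (fun p q : ℕ × ℕ => q.1 = p.1 + 1 ∧ q.2 = F v p.1 p.2) (0, v a) p ↔
        p.2 = Nat.rec (v a) (F v) p.1 := by
    constructor
    · intro h
      induction h with
      | refl => rfl
      | tail _ hbc ih => rw [hbc.1, hbc.2, ih]
    · obtain ⟨n, r⟩ := p
      intro h
      change r = Nat.rec (v a) (F v) n at h
      subst h
      induction n with
      | zero => exact .refl
      | succ n ih => exact ih.tail ⟨rfl, rfl⟩
  -- The starting index `0` must be held in a register, so one more is guessed and tested for zero.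
  have := (eq_zero (0 : Fin (k + 1))).and (reflTransGen
    (P := fun v p q => q.1 = p.1 + 1 ∧ q.2 = F (fun i => v i.succ) p.1 p.2)
    ((eq_succ 2 0).and h) 0 a.succ n.succ r.succ)
  refine (ex (P := fun v z => z = 0 ∧ Relation.ReflTransGen
    (fun p q : ℕ × ℕ => q.1 = p.1 + 1 ∧ q.2 = F v p.1 p.2) (z, v a) (v n, v r)) this).congr
    fun v => ?_
  simp only [exists_eq_left, key]

theorem eq_add (i j l : Fin k) : Testable k (fun v => v l = v i + v j) := by
  refine (rec_eq (F := fun _ _ y => y + 1) (eq_succ 3 1) i j l).congr fun v => ?_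
  have (n : ℕ) : (Nat.rec (v i) (fun _ y => y + 1) n : ℕ) = v i + n := by
    induction n with
    | zero => rfl
    | succ n ih => rw [← add_assoc, ← ih]
  rw [this]

theorem eq_mul (i j l : Fin k) : Testable k (fun v => v l = v i * v j) := by
  have h := rec_eq (F := fun v : Fin (k + 1) → ℕ => fun _ y => y + v i.succ)
    (eq_add 3 i.succ.succ.succ.succ.succ.succ 1) 0 j.succ l.succ
  refine (ex (P := fun v z => z = 0 ∧ v l = Nat.rec z (fun _ y => y + v i) (v j))
    ((eq_zero 0).and h)).congr fun v => ?_
  have (n : ℕ) : (Nat.rec 0 (fun _ y => y + v i) n : ℕ) = v i * n := by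
    induction n with
    | zero => rfl
    | succ n ih => rw [mul_add, mul_one, ← ih]
  simp only [exists_eq_left, this]

theorem lt (i j : Fin k) : Testable k (fun v => v i < v j) := by
  refine (ex (P := fun v z => ∃ y, y = z + 1 ∧ v j = v i + y)
    (ex (P := fun x y => y = x 0 + 1 ∧ x j.succ = x i.succ + y)
      ((eq_succ 1 0).and (eq_add i.succ.succ 0 j.succ.succ)))).congr fun v => ?_
  simp only [exists_eq_left]
  rw [Nat.lt_iff_add_one_le, le_iff_exists_add]
  simp only [add_assoc, add_comm 1]

theorem le (i j : Fin k) : Testable k (fun v => v i ≤ v j) := by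
  refine (ex (P := fun v z => v j = v i + z) (eq_add i.succ 0 j.succ)).congr fun v => ?_
  rw [le_iff_exists_add]

theorem eq_pair (i j l : Fin k) : Testable k (fun v => v l = Nat.pair (v i) (v j)) := by
  -- `h1` and `h2` are the two branches in the definition of `Nat.pair`.
  have h1 := (lt i j).and (ex (P := fun v m => m = v j * v j ∧ v l = m + v i)
    ((eq_mul j.succ j.succ 0).and (eq_add 0 i.succ l.succ)))
  have h2 := (le j i).and (ex (P := fun v m => m = v i * v i ∧ ∃ n, n = m + v i ∧ v l = n + v j)
    ((eq_mul i.succ i.succ 0).and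
    (ex (P := fun x n => n = x 0 + x i.succ ∧ x l.succ = n + x j.succ)
      ((eq_add 1 i.succ.succ 0).and (eq_add 0 j.succ.succ l.succ.succ)))))
  refine (h1.or h2).congr fun v => ?_
  simp only [exists_eq_left, Nat.pair]
  split_ifs with h
  · simp [h, h.not_ge]
  · simp [h, not_lt.1 h]

/-- Functions are handled through their graphs: projections guess the other component of the pair,
composition guesses the intermediate value, and recursion is `rec_eq`. -/
theorem eq_primrec {f : ℕ → ℕ} (hf : Nat.Primrec f) :
    ∀ (k : ℕ) (i j : Fin k), Testable k (fun v => v j = f (v i)) := by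
  induction hf with
  | zero => exact fun k i j => eq_zero j
  | succ => exact fun k i j => eq_succ i j
  | left =>
    intro k i j
    refine (ex (P := fun v z => v i = Nat.pair (v j) z) (eq_pair j.succ 0 i.succ)).congr
      fun v => ⟨fun h => ⟨(Nat.unpair (v i)).2, by rw [h, Nat.pair_unpair]⟩, ?_⟩
    rintro ⟨z, hz⟩
    simp [hz]
  | right =>
    intro k i j
    refine (ex (P := fun v z => v i = Nat.pair z (v j)) (eq_pair 0 j.succ i.succ)).congr
      fun v => ⟨fun h => ⟨(Nat.unpair (v i)).1, by rw [h, Nat.pair_unpair]⟩, ?_⟩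
    rintro ⟨z, hz⟩
    simp [hz]
  | @pair f g _ _ hf hg =>
    intro k i j
    refine (ex (P := fun v a => a = f (v i) ∧ ∃ b, b = g (v i) ∧ v j = Nat.pair a b)
      ((hf _ i.succ 0).and (ex (P := fun x b => b = g (x i.succ) ∧ x j.succ = Nat.pair (x 0) b)
        ((hg _ i.succ.succ 0).and (eq_pair 1 0 j.succ.succ))))).congr fun v => ?_
    simp only [exists_eq_left]
  | @comp f g _ _ hf hg =>
    intro k i j
    refine (ex (P := fun v a => a = g (v i) ∧ v j = f a)
      ((hg _ i.succ 0).and (hf _ 0 j.succ))).congr fun v => ?_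
    simp only [exists_eq_left]
  | @prec f g _ _ hf hg =>
    intro k i j
    have step (a n r z : Fin (k + 3)) : Testable (k + 3)
        (fun v => v r = Nat.rec (v a) (fun y IH => g (Nat.pair (v z) (Nat.pair y IH))) (v n)) := by
      refine rec_eq (F := fun v y IH => g (Nat.pair (v z) (Nat.pair y IH))) ?_ a n r
      refine (ex (P := fun x m => m = Nat.pair (x 2) (x 3) ∧ ∃ l,
        l = Nat.pair (x z.succ.succ.succ.succ.succ) m ∧ x 1 = g l)
        ((eq_pair 3 4 0).and (ex (P := fun x l =>
          l = Nat.pair (x z.succ.succ.succ.succ.succ.succ) (x 0) ∧ x 2 = g l)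
          ((eq_pair z.succ.succ.succ.succ.succ.succ.succ 1 0).and (hg _ 0 3))))).congr fun v => ?_
      simp only [exists_eq_left]
    have h := ex (P := fun v z => ∃ n, v i = Nat.pair z n ∧ ∃ a, a = f z ∧ v j =
      Nat.rec a (fun y IH => g (Nat.pair z (Nat.pair y IH))) n)
      (ex (P := fun x n => x i.succ = Nat.pair (x 0) n ∧ ∃ a, a = f (x 0) ∧ x j.succ =
        Nat.rec a (fun y IH => g (Nat.pair (x 0) (Nat.pair y IH))) n)
        ((eq_pair 1 0 i.succ.succ).and (ex (P := fun x a => a = f (x 1) ∧ x j.succ.succ =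
        Nat.rec a (fun y IH => g (Nat.pair (x 1) (Nat.pair y IH))) (x 0))
        ((hf _ 2 0).and (step 0 1 j.succ.succ.succ 2)))))
    refine h.congr fun v => ⟨fun h => ?_, ?_⟩
    · exact ⟨_, _, (Nat.pair_unpair (v i)).symm, _, rfl, h⟩
    · rintro ⟨z, n, hz, _, rfl, h⟩
      rw [h, hz]
      simp

end Testable

/-- Every recursively enumerable set of natural numbers is the set of the numbers `n` such that a
fixed two-counter machine has a complete run from the counter values `(2 ^ n, 0)`. -/
theorem exists_definable_of_primrec {f : ℕ → ℕ → ℕ} (hf : Primrec₂ f) :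
    ∃ R, CounterAction.Definable R ∧ ∀ n, (∃ t, R ![2 ^ n, 0] t) ↔ ∃ m, f n m = 0 := by
  have hf' : Nat.Primrec (fun z => f z.unpair.1 z.unpair.2) :=
    Primrec.nat_iff.1 (hf.comp (Primrec.fst.comp Primrec.unpair) (Primrec.snd.comp Primrec.unpair))
  have h : Testable 1 (fun v => ∃ m, f (v 0) m = 0) := by
    refine (Testable.ex (P := fun v m => ∃ z, z = Nat.pair (v 0) m ∧ ∃ y, y = 0 ∧
        y = f z.unpair.1 z.unpair.2)
      (Testable.ex (P := fun x z => z = Nat.pair (x 1) (x 0) ∧ ∃ y, y = 0 ∧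
        y = f z.unpair.1 z.unpair.2)
      ((Testable.eq_pair 2 1 0).and (Testable.ex
        (P := fun x y => y = 0 ∧ y = f (x 0).unpair.1 (x 0).unpair.2)
        ((Testable.eq_zero 0).and (Testable.eq_primrec hf' _ 1 0)))))).congr fun v => ?_
    simp only [exists_eq_left, Nat.unpair_pair, eq_comm]
  -- The single visible register is coded by the prime `2`, which is why the input appears as `2 ^
  -- n`.
  obtain ⟨R, hR, hR'⟩ := RegisterRel.exists_definable h ![2]
    (fun i => by simpa using Nat.prime_two) (Function.injective_of_subsingleton _)
  refine ⟨R, hR, fun n => ?_⟩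
  have hn : primeCode ![2] ![n] = 2 ^ n := by simp [primeCode]
  rw [← hn]
  simp only [hR']
  constructor
  · rintro ⟨_, _, -, ⟨m, hm⟩, rfl⟩
    exact ⟨m, hm⟩
  · rintro ⟨m, hm⟩
    exact ⟨_, _, rfl, ⟨m, hm⟩, rfl⟩

/-! ### Executions that ignore zero tests -/

namespace CounterAction

/-- The effect of an instruction on the counters, where zero tests are ignored. -/
def effect : CounterAction → Fin 2 → ℤ
  | inc i => Pi.single i 1
  | dec i => -Pi.single i 1
  | test _ => 0

/-- Execution of an instruction, where zero tests are ignored. -/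
def WeakStep (a : CounterAction) (s t : Fin 2 → ℕ) : Prop :=
  ∀ i, (t i : ℤ) = s i + a.effect i

/-- Execution of a sequence of instructions, where zero tests are ignored. -/
def WeakExec : List CounterAction → (Fin 2 → ℕ) → (Fin 2 → ℕ) → Prop
  | [], s, t => s = t
  | a :: w, s, t => ∃ u, a.WeakStep s u ∧ WeakExec w u t

/-- Some zero test is executed while its counter is positive. -/
def Cheats : List CounterAction → (Fin 2 → ℕ) → Prop
  | [], _ => False
  | a :: w, s => (∃ i, a = test i ∧ 0 < s i) ∨ ∃ u, a.WeakStep s u ∧ Cheats w u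

theorem step_iff {a : CounterAction} {s t : Fin 2 → ℕ} :
    a.Step s t ↔ a.WeakStep s t ∧ ¬ ∃ i, a = test i ∧ 0 < s i := by
  cases a with
  | inc i =>
    simp only [Step, WeakStep, effect, funext_iff, Pi.add_apply, reduceCtorEq, false_and,
      exists_false, not_false_eq_true, and_true]
    refine forall_congr' fun j => ?_
    by_cases hj : j = i
    · subst hj; simp; omega
    · simp [hj]
  | dec i =>
    simp only [Step, WeakStep, effect, funext_iff, Pi.add_apply, Pi.neg_apply, reduceCtorEq,
      false_and, exists_false, not_false_eq_true, and_true]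
    refine forall_congr' fun j => ?_
    by_cases hj : j = i
    · subst hj; simp; omega
    · simp [hj]; omega
  | test i =>
    simp [Step, WeakStep, effect, funext_iff, and_comm]

theorem WeakStep.right_unique {a : CounterAction} {s t t' : Fin 2 → ℕ} (h : a.WeakStep s t)
    (h' : a.WeakStep s t') : t = t' := by
  ext i
  have h1 := h i
  have h2 := h' i
  omega

/-- Weak execution is deterministic, so a cheat on some weak execution of `w` is a cheat on the one
leading to `t`. -/
theorem exec_iff {w : List CounterAction} {s t : Fin 2 → ℕ} :
    Exec w s t ↔ WeakExec w s t ∧ ¬ Cheats w s := by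
  induction w generalizing s with
  | nil => simp [Exec, WeakExec, Cheats]
  | cons a w ih =>
    simp only [Exec, WeakExec, Cheats, step_iff, ih, not_or]
    constructor
    · rintro ⟨u, ⟨h1, h2⟩, h3, h4⟩
      refine ⟨⟨u, h1, h3⟩, h2, ?_⟩
      rintro ⟨u', h5, h6⟩
      rw [h5.right_unique h1] at h6
      exact h4 h6
    · rintro ⟨⟨u, h1, h3⟩, h2, h4⟩
      exact ⟨u, ⟨h1, h2⟩, h3, fun h5 => h4 ⟨u, h1, h5⟩⟩

end CounterAction

/-! ### Runs of VASSs, and determinism -/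

namespace VASS

open CounterAction

section Run

variable {k : ℕ} {σ Q : Type*} [Finite σ] [Finite Q] {V : VASS k σ Q}

theorem isRun_nil_iff {c c' : Config k Q} : V.IsRun c [] c' ↔ c = c' :=
  ⟨fun h => by cases h; rfl, by rintro rfl; exact .nil c⟩

theorem isRun_cons_iff {t : Transition k σ Q} {ρ : List (Transition k σ Q)} {c c' : Config k Q} :
    V.IsRun c (t :: ρ) c' ↔ ∃ d, t ∈ V.trans ∧ Fires t c d ∧ V.IsRun d ρ c' :=
  ⟨fun h => by cases h with | cons h1 h2 h3 => exact ⟨_, h1, h2, h3⟩,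
    fun ⟨_, h1, h2, h3⟩ => .cons h1 h2 h3⟩

/-- The configuration `c'` is reached from `c` by some run over the word `w`. -/
def Reads (V : VASS k σ Q) (w : List σ) (c c' : Config k Q) : Prop :=
  ∃ ρ, ρ.map Transition.letter = w ∧ V.IsRun c ρ c'

theorem mem_language_iff {w : List σ} :
    w ∈ V.language ↔ ∃ c, V.Reads w V.init c ∧ V.IsAccepting c :=
  ⟨fun ⟨ρ, h1, c, h2, h3⟩ => ⟨c, ⟨ρ, h1, h2⟩, h3⟩, fun ⟨c, ⟨ρ, h1, h2⟩, h3⟩ => ⟨ρ, h1, c, h2, h3⟩⟩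

theorem reads_nil_iff {c c' : Config k Q} : V.Reads [] c c' ↔ c = c' := by
  constructor
  · rintro ⟨ρ, h1, h2⟩
    rw [List.map_eq_nil_iff] at h1
    subst h1
    exact isRun_nil_iff.1 h2
  · intro h
    exact ⟨[], rfl, isRun_nil_iff.2 h⟩

theorem reads_cons_iff {a : σ} {w : List σ} {c c' : Config k Q} :
    V.Reads (a :: w) c c' ↔
      ∃ v d, (c.1, a, v, d.1) ∈ V.trans ∧ (∀ i, (d.2 i : ℤ) = c.2 i + v i) ∧ V.Reads w d c' := by
  constructor
  · rintro ⟨ρ, h1, h2⟩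
    obtain ⟨⟨s, b, v, s'⟩, ρ, rfl, rfl, rfl⟩ := List.map_eq_cons_iff.1 h1
    obtain ⟨d, h3, ⟨rfl, rfl, h4⟩, h5⟩ := isRun_cons_iff.1 h2
    exact ⟨v, d, h3, h4, ρ, rfl, h5⟩
  · rintro ⟨v, d, h3, h4, ρ, rfl, h5⟩
    exact ⟨(c.1, a, v, d.1) :: ρ, rfl, isRun_cons_iff.2 ⟨d, h3, ⟨rfl, rfl, h4⟩, h5⟩⟩

/-- A VASS whose transitions are determined by source state and letter is unambiguous. -/
theorem isUnambiguous_of_deterministic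
    (h : ∀ s a v t v' t', (s, a, v, t) ∈ V.trans → (s, a, v', t') ∈ V.trans → v = v' ∧ t = t') :
    V.IsUnambiguous := by
  have key : ∀ (ρ ρ' : List (Transition k σ Q)) (c d d' : Config k Q),
      ρ.map Transition.letter = ρ'.map Transition.letter → V.IsRun c ρ d → V.IsRun c ρ' d' →
        ρ = ρ' := by
    intro ρ
    induction ρ with
    | nil =>
      intro ρ' c d d' h1 _ _
      exact (List.map_eq_nil_iff.1 h1.symm).symm
    | cons t ρ ih =>
      intro ρ' c d d' h1 h2 h3
      obtain ⟨t', ρ', rfl, h4, h5⟩ := List.map_eq_cons_iff.1 h1.symm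
      obtain ⟨e, m1, f1, r1⟩ := isRun_cons_iff.1 h2
      obtain ⟨e', m2, f2, r2⟩ := isRun_cons_iff.1 h3
      obtain ⟨s, a, v, q⟩ := t
      obtain ⟨s', a', v', q'⟩ := t'
      obtain rfl : a' = a := h4
      obtain ⟨rfl, e1, w1⟩ := f1
      obtain ⟨rfl, e2, w2⟩ := f2
      obtain ⟨rfl, rfl⟩ := h _ _ _ _ _ _ m1 m2
      have he : e = e' := by
        refine Prod.ext (e1.trans e2.symm) (funext fun i => ?_)
        have := w1 i
        have := w2 i
        omega
      subst he
      rw [ih ρ' e d d' h5.symm r1 r2]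
  rintro w ⟨ρ, h1, c, h2, h3⟩
  exact ⟨ρ, ⟨h1, c, h2, h3⟩, fun ρ' ⟨h1', c', h2', _⟩ => key _ _ _ _ _ (h1'.trans h1.symm) h2' h2⟩

end Run

/-! ### The deterministic VASS, and the nondeterministic VASS that detects cheating -/

section Reduction

variable {m n n' : ℕ} (e : CounterAction ≃ Fin m) (D : DFA CounterAction (Fin n))

open Classical in
/-- The VASS which executes the words of a finite automaton, but ignores zero tests. -/
noncomputable def weakMachine (u : Fin 2 → ℕ) : VASS 2 (Fin m) (Fin n) where
  init := (D.start, u)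
  final := (Finset.univ.filter (· ∈ D.accept)).image fun q => (q, 0)
  trans := Finset.univ.image fun p : Fin n × Fin m =>
    (p.1, p.2, (e.symm p.2).effect, D.step p.1 (e.symm p.2))

theorem mem_weakMachine_trans {u : Fin 2 → ℕ} {s t : Fin n} {a : Fin m} {v : Fin 2 → ℤ} :
    (s, a, v, t) ∈ (weakMachine e D u).trans ↔
      v = (e.symm a).effect ∧ t = D.step s (e.symm a) := by
  simp only [weakMachine, Finset.mem_image, Finset.mem_univ, true_and, Prod.exists, Prod.mk.injEq]
  constructor
  · rintro ⟨_, _, rfl, rfl, rfl, rfl⟩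
    exact ⟨rfl, rfl⟩
  · rintro ⟨rfl, rfl⟩
    exact ⟨_, _, rfl, rfl, rfl, rfl⟩

theorem weakMachine_isUnambiguous (u : Fin 2 → ℕ) : (weakMachine e D u).IsUnambiguous := by
  refine isUnambiguous_of_deterministic fun s a v t v' t' h h' => ?_
  rw [mem_weakMachine_trans] at h h'
  exact ⟨h.1.trans h'.1.symm, h.2.trans h'.2.symm⟩

theorem weakMachine_reads_iff (u : Fin 2 → ℕ) (w : List CounterAction)
    (c c' : Config 2 (Fin n)) :
    (weakMachine e D u).Reads (w.map e) c c' ↔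
      c'.1 = D.evalFrom c.1 w ∧ WeakExec w c.2 c'.2 := by
  induction w generalizing c with
  | nil =>
    rw [List.map_nil, reads_nil_iff, DFA.evalFrom_nil, WeakExec, Prod.ext_iff, eq_comm]
  | cons a w ih =>
    rw [List.map_cons, reads_cons_iff]
    simp only [mem_weakMachine_trans, Equiv.symm_apply_apply, ih, DFA.evalFrom_cons, WeakExec]
    constructor
    · rintro ⟨_, ⟨_, d⟩, ⟨rfl, rfl⟩, h1, h2, h3⟩
      exact ⟨h2, d, h1, h3⟩
    · rintro ⟨h2, d, h1, h3⟩
      exact ⟨_, (_, d), ⟨rfl, rfl⟩, h1, h2, h3⟩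

theorem mem_weakMachine_language {u : Fin 2 → ℕ} {w : List CounterAction} :
    w.map e ∈ (weakMachine e D u).language ↔ w ∈ D.accepts ∧ ∃ t, WeakExec w u t := by
  rw [mem_language_iff]
  simp only [weakMachine_reads_iff]
  constructor
  · rintro ⟨⟨_, t⟩, ⟨rfl, h2⟩, ⟨q, _⟩, h3, rfl, -⟩
    simp only [weakMachine, Finset.mem_image, Finset.mem_filter, Finset.mem_univ, true_and] at h3
    obtain ⟨q', h3, h4⟩ := h3
    rw [Prod.mk.injEq] at h4
    rw [h4.1] at h3
    exact ⟨h3, t, h2⟩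
  · rintro ⟨h1, t, h2⟩
    refine ⟨(D.eval w, t), ⟨rfl, h2⟩, (D.eval w, 0), ?_, rfl, fun i => Nat.zero_le _⟩
    simp only [weakMachine, Finset.mem_image, Finset.mem_filter, Finset.mem_univ, true_and]
    exact ⟨_, h1, rfl⟩

/-- The phases of the search for a zero test on a positive counter: it is still to come
(`none`), it was on the counter `i` in the last step, where the counter was decremented
(`some (some i)`), or it was earlier (`some none`). -/
abbrev Phase := Option (Option (Fin 2))

/-- The transitions between the phases, with their effects on the counters. -/
inductive PhaseStep : CounterAction → Phase → (Fin 2 → ℤ) → Phase → Prop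
  | wait (a : CounterAction) : PhaseStep a none a.effect none
  | guess (i : Fin 2) : PhaseStep (test i) none (-Pi.single i 1) (some (some i))
  | restore (a : CounterAction) (i : Fin 2) :
      PhaseStep a (some (some i)) (a.effect + Pi.single i 1) (some none)
  | done (a : CounterAction) : PhaseStep a (some none) a.effect (some none)

variable (e' : Fin n × Phase ≃ Fin n')

/-- An instruction changes a counter by at most `1` and `restore` adds at most `1` more, so all
effects have entries between `-2` and `2`. -/
theorem finite_cheatTransitions : {t : Fin n' × Fin m × (Fin 2 → ℤ) × Fin n' |
    (e'.symm t.2.2.2).1 = D.step (e'.symm t.1).1 (e.symm t.2.1) ∧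
      PhaseStep (e.symm t.2.1) (e'.symm t.1).2 t.2.2.1 (e'.symm t.2.2.2).2}.Finite := by
  have hv : {v : Fin 2 → ℤ | ∀ i, v i ∈ Set.Icc (-2 : ℤ) 2}.Finite :=
    Set.Finite.pi' fun _ => Set.finite_Icc _ _
  refine (Set.finite_univ.prod (Set.finite_univ.prod (hv.prod Set.finite_univ))).subset ?_
  have heff (a : CounterAction) (i : Fin 2) : -1 ≤ a.effect i ∧ a.effect i ≤ 1 := by
    cases a <;> simp only [effect, Pi.neg_apply, Pi.single_apply, Pi.zero_apply] <;>
      (try split_ifs) <;> norm_num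
  rintro ⟨s, a, v, t⟩ ⟨-, h⟩
  refine ⟨trivial, trivial, fun l => ?_, trivial⟩
  change PhaseStep (e.symm a) (e'.symm s).2 v (e'.symm t).2 at h
  change v l ∈ Set.Icc (-2 : ℤ) 2
  generalize e.symm a = b at h
  generalize (e'.symm s).2 = x at h
  generalize (e'.symm t).2 = y at h
  have := heff b l
  cases h with
  | wait => exact ⟨by omega, by omega⟩
  | done => exact ⟨by omega, by omega⟩
  | guess i =>
    rw [Pi.neg_apply, Pi.single_apply]
    split_ifs <;> norm_num
  | restore _ i =>
    rw [Pi.add_apply, Pi.single_apply]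
    split_ifs <;> exact ⟨by omega, by omega⟩

open Classical in
/-- The VASS which executes the words of a finite automaton in which some zero test is executed
while its counter is positive; other zero tests are ignored. -/
noncomputable def cheatMachine (u : Fin 2 → ℕ) : VASS 2 (Fin m) (Fin n') where
  init := (e' (D.start, none), u)
  final := (Finset.univ.filter (fun q => (e'.symm q).1 ∈ D.accept ∧ (e'.symm q).2 ≠ none)).image
    fun q => (q, 0)
  trans := (finite_cheatTransitions e D e').toFinset

theorem mem_cheatMachine_trans {u : Fin 2 → ℕ} {s t : Fin n'} {a : Fin m} {v : Fin 2 → ℤ} :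
    (s, a, v, t) ∈ (cheatMachine e D e' u).trans ↔
      (e'.symm t).1 = D.step (e'.symm s).1 (e.symm a) ∧
        PhaseStep (e.symm a) (e'.symm s).2 v (e'.symm t).2 := by
  rw [cheatMachine, Set.Finite.mem_toFinset]
  rfl

/-- The sequences of phase transitions over a word, with their effects on the counters. -/
def PhaseExec : List CounterAction → Phase → (Fin 2 → ℕ) → Phase → (Fin 2 → ℕ) → Prop
  | [], x, s, y, t => x = y ∧ s = t
  | a :: w, x, s, y, t => ∃ v z r, PhaseStep a x v z ∧ (∀ i, (r i : ℤ) = s i + v i) ∧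
      PhaseExec w z r y t

theorem cheatMachine_reads_iff (u : Fin 2 → ℕ) (w : List CounterAction)
    (q : Fin n) (x : Phase) (s : Fin 2 → ℕ) (q' : Fin n) (y : Phase) (t : Fin 2 → ℕ) :
    (cheatMachine e D e' u).Reads (w.map e) (e' (q, x), s) (e' (q', y), t) ↔
      q' = D.evalFrom q w ∧ PhaseExec w x s y t := by
  induction w generalizing q x s with
  | nil =>
    rw [List.map_nil, reads_nil_iff, DFA.evalFrom_nil, PhaseExec, Prod.mk.injEq,
      e'.injective.eq_iff, Prod.mk.injEq, and_assoc, eq_comm]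
  | cons a w ih =>
    rw [List.map_cons, reads_cons_iff]
    simp only [mem_cheatMachine_trans, Equiv.symm_apply_apply, DFA.evalFrom_cons, PhaseExec]
    constructor
    · rintro ⟨v, ⟨p, r⟩, ⟨h1, h2⟩, h3, h4⟩
      obtain ⟨⟨p, z⟩, rfl⟩ := e'.surjective p
      rw [Equiv.symm_apply_apply] at h1 h2
      obtain rfl : p = _ := h1
      rw [ih] at h4
      exact ⟨h4.1, v, z, r, h2, h3, h4.2⟩
    · rintro ⟨h1, v, z, r, h2, h3, h4⟩
      refine ⟨v, (e' (D.step q a, z), r), ?_, h3, (ih _ _ _).2 ⟨h1, h4⟩⟩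
      rw [Equiv.symm_apply_apply]
      exact ⟨rfl, h2⟩

theorem phaseExec_done {w : List CounterAction} {s t : Fin 2 → ℕ} {y : Phase} :
    PhaseExec w (some none) s y t ↔ y = some none ∧ WeakExec w s t := by
  induction w generalizing s with
  | nil => simp [PhaseExec, WeakExec, eq_comm]
  | cons a w ih =>
    simp only [PhaseExec, WeakExec]
    constructor
    · rintro ⟨v, z, r, h1, h2, h3⟩
      cases h1
      exact ⟨(ih.1 h3).1, r, h2, (ih.1 h3).2⟩
    · rintro ⟨h1, r, h2, h3⟩
      exact ⟨_, _, r, .done a, h2, ih.2 ⟨h1, h3⟩⟩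

/-- The missing unit is returned in the same transition as the next instruction. Only the total
effect must keep the counters nonnegative, so the step fires exactly as it would from the
undecremented vector. If no letter follows, the pending phase itself is accepting. -/
theorem exists_phaseExec_pending {w : List CounterAction} {s : Fin 2 → ℕ} {i : Fin 2} :
    (∃ y t, y ≠ none ∧ PhaseExec w (some (some i)) s y t) ↔
      ∃ t, WeakExec w (s + Pi.single i 1) t := by
  cases w with
  | nil => simp [PhaseExec, WeakExec]
  | cons a w =>
    simp only [PhaseExec, WeakExec, WeakStep]
    constructor
    · rintro ⟨y, t, hy, v, z, r, h1, h2, h3⟩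
      cases h1
      refine ⟨t, r, fun j => ?_, (phaseExec_done.1 h3).2⟩
      rw [h2]
      by_cases hj : j = i
      · subst hj; simp; ring
      · simp [hj]
    · rintro ⟨t, r, h2, h3⟩
      refine ⟨some none, t, by simp, _, _, r, .restore a i, fun j => ?_,
        phaseExec_done.2 ⟨rfl, h3⟩⟩
      rw [h2]
      by_cases hj : j = i
      · subst hj; simp; ring
      · simp [hj]

/-- The decrement made by `guess i` can fire exactly if the counter `i` is positive at that zero
test. Acceptance outside `none` forces such a guess to occur. -/
theorem exists_phaseExec_none {w : List CounterAction} {s : Fin 2 → ℕ} :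
    (∃ y t, y ≠ none ∧ PhaseExec w none s y t) ↔ (∃ t, WeakExec w s t) ∧ Cheats w s := by
  induction w generalizing s with
  | nil =>
    simp [PhaseExec, Cheats]
  | cons a w ih =>
    constructor
    · rintro ⟨y, t, hy, v, z, r, h1, h2, h3⟩
      cases h1 with
      | wait =>
        obtain ⟨⟨t', h4⟩, h5⟩ := ih.1 ⟨y, t, hy, h3⟩
        exact ⟨⟨t', r, h2, h4⟩, .inr ⟨r, h2, h5⟩⟩
      | guess i =>
        obtain ⟨t', h4⟩ := exists_phaseExec_pending.1 ⟨y, t, hy, h3⟩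
        have hs : r + Pi.single i 1 = s := by
          ext j
          have := h2 j
          by_cases hj : j = i
          · subst hj; simp at this ⊢; omega
          · simp [hj] at this ⊢; omega
        rw [hs] at h4
        refine ⟨⟨t', s, by simp [WeakStep, effect], h4⟩, .inl ⟨i, rfl, ?_⟩⟩
        rw [← hs]
        simp
    · rintro ⟨⟨t, r, h2, h4⟩, ⟨i, rfl, hi⟩ | ⟨r', h2', h5⟩⟩
      · have hr : s = r := by
          ext j
          have := h2 j
          simp [effect] at this
          omega
        subst hr
        have hs : s = s - Pi.single i 1 + Pi.single i 1 := by
          ext j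
          by_cases hj : j = i
          · subst hj; simp; omega
          · simp [hj]
        rw [hs] at h4
        obtain ⟨y, t', hy, h⟩ := exists_phaseExec_pending.2 ⟨t, h4⟩
        refine ⟨y, t', hy, _, _, _, .guess i, fun j => ?_, h⟩
        by_cases hj : j = i
        · subst hj; simp; omega
        · simp [hj]
      · obtain rfl := h2.right_unique h2'
        obtain ⟨y, t', hy, h⟩ := ih.2 ⟨⟨t, h4⟩, h5⟩
        exact ⟨y, t', hy, _, _, r, .wait a, h2, h⟩

theorem mem_cheatMachine_language {u : Fin 2 → ℕ} {w : List CounterAction} :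
    w.map e ∈ (cheatMachine e D e' u).language ↔
      w ∈ D.accepts ∧ (∃ t, WeakExec w u t) ∧ Cheats w u := by
  rw [mem_language_iff, ← exists_phaseExec_none]
  constructor
  · rintro ⟨⟨_, t⟩, h1, ⟨q, _⟩, h3, rfl, -⟩
    obtain ⟨⟨q, y⟩, rfl⟩ := e'.surjective q
    obtain ⟨rfl, h2⟩ := (cheatMachine_reads_iff e D e' u w _ _ _ _ _ _).1 h1
    simp only [cheatMachine, Finset.mem_image, Finset.mem_filter, Finset.mem_univ, true_and] at h3
    obtain ⟨q', ⟨h3, h5⟩, h4⟩ := h3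
    rw [Prod.mk.injEq] at h4
    rw [h4.1, Equiv.symm_apply_apply] at h3 h5
    exact ⟨h3, y, t, h5, h2⟩
  · rintro ⟨h1, y, t, hy, h2⟩
    refine ⟨(e' (D.eval w, y), t), (cheatMachine_reads_iff e D e' u w _ _ _ _ _ _).2 ⟨rfl, h2⟩,
      (e' (D.eval w, y), 0), ?_, rfl, fun i => Nat.zero_le _⟩
    simp only [cheatMachine, Finset.mem_image, Finset.mem_filter, Finset.mem_univ, true_and]
    exact ⟨_, by rw [Equiv.symm_apply_apply]; exact ⟨h1, hy⟩, rfl⟩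

/-- One inclusion always holds; equality says that every weakly executable word of `D` cheats, so
none is executed genuinely. -/
theorem weakMachine_language_eq_iff (u : Fin 2 → ℕ) :
    (weakMachine e D u).language = (cheatMachine e D e' u).language ↔
      ¬ ∃ t, ∃ w ∈ D.accepts, Exec w u t := by
  constructor
  · rintro h ⟨t, w, h1, h2⟩
    rw [exec_iff] at h2
    have := (mem_weakMachine_language e D).2 ⟨h1, t, h2.1⟩
    rw [h, mem_cheatMachine_language] at this
    exact h2.2 this.2.2
  · intro h
    ext w
    obtain ⟨w, rfl⟩ : ∃ w' : List CounterAction, w'.map e = w := ⟨w.map e.symm, by simp⟩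
    rw [mem_weakMachine_language, mem_cheatMachine_language]
    refine and_congr_right fun h1 => (and_iff_left_of_imp ?_).symm
    rintro ⟨t, h2⟩
    by_contra h3
    exact h ⟨t, w, h1, exec_iff.2 ⟨h2, h3⟩⟩

end Reduction

end VASS

/-! ### Computability of the reduction and undecidability -/

namespace VASS

/-- The description which lists the final configurations and the transitions of a VASS. -/
noncomputable def toCode {k m n : ℕ} (V : VASS k (Fin m) (Fin n)) : Code k :=
  (m, n, (V.init.1, V.init.2), V.final.toList.map fun d => ((d.1 : ℕ), d.2),
    V.trans.toList.map fun s => ((s.1 : ℕ), (s.2.1 : ℕ), s.2.2.1, (s.2.2.2 : ℕ)))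

theorem describes_toCode {k m n : ℕ} (V : VASS k (Fin m) (Fin n)) : Describes V.toCode V := by
  refine ⟨rfl, rfl, rfl, fun c => ?_, fun t => ?_⟩ <;>
    simp only [List.mem_map, Finset.mem_toList, eq_comm]

end VASS

theorem primrec_two_pow_pair : Primrec (fun n : ℕ => (![2 ^ n, 0] : Fin 2 → ℕ)) := by
  have hpow : Primrec (fun n : ℕ => 2 ^ n) :=
    (Primrec.nat_rec₁ 1 (Primrec.nat_mul.comp Primrec.snd (Primrec.const 2)).to₂).of_eq fun n => by
      induction n with
      | zero => rfl
      | succ n ih => rw [pow_succ, ← ih]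
  refine Primrec.fin_curry.2 ?_
  refine (Primrec.ite (c := fun p : ℕ × Fin 2 => p.2 = 0)
    (Primrec.eq.comp Primrec.snd (Primrec.const 0)) (hpow.comp Primrec.fst)
    (Primrec.const 0)).of_eq ?_
  rintro ⟨n, i⟩
  fin_cases i <;> rfl

open CounterAction Nat.Partrec in
/-- There is a two-counter machine which has a complete run from `(2 ^ n, 0)` iff the `n`-th partial
recursive program halts on the input `0`. -/
theorem exists_definable_halting : ∃ R, Definable R ∧
    ∀ n, (∃ t, R ![2 ^ n, 0] t) ↔ (Code.eval (Denumerable.ofNat Code n) 0).Dom := by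
  -- The value is `0` iff `Code.evaln` with bound `m` yields a result, so a zero exists iff the
  -- program halts.
  have hf : Primrec₂ (fun n m : ℕ =>
      bif (Code.evaln m (Denumerable.ofNat Code n) 0).isSome then 0 else 1) :=
    Primrec.cond (Primrec.option_isSome.comp (Code.primrec_evaln.comp
      ((Primrec.snd.pair ((Primrec.ofNat Code).comp Primrec.fst)).pair (Primrec.const 0))))
      (Primrec.const 0) (Primrec.const 1)
  obtain ⟨R, hR, h⟩ := exists_definable_of_primrec hf
  refine ⟨R, hR, fun n => (h n).trans ?_⟩
  rw [Part.dom_iff_mem]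
  simp only [Code.evaln_complete]
  rw [exists_comm]
  refine exists_congr fun m => ?_
  rw [Bool.cond_eq_ite]
  simp [Option.isSome_iff_exists]

/-- No algorithm (partial recursive function), given descriptions of a 2-VASS `A` and a 2-VASS `B`
over a common finite alphabet such that `A` is unambiguous, always halts and correctly answers
whether `L(A) = L(B)`. Its behaviour on all other inputs is unrestricted. -/
theorem corollary4 :
    ¬ ∃ f : VASS.Code 2 × VASS.Code 2 →. Bool, Partrec f ∧
      ∀ (m n n' : ℕ) (A : VASS 2 (Fin m) (Fin n)) (B : VASS 2 (Fin m) (Fin n'))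
        (a b : VASS.Code 2), VASS.Describes a A → VASS.Describes b B → A.IsUnambiguous →
          ∃ r ∈ f (a, b), (r = true ↔ A.language = B.language) := by
  rintro ⟨f, hf, h⟩
  obtain ⟨R, ⟨L, ⟨σ, _, D₀, rfl⟩, hL⟩, hR⟩ := exists_definable_halting
  obtain ⟨m, ⟨e⟩⟩ := Finite.exists_equiv_fin CounterAction
  obtain ⟨n, ⟨g⟩⟩ := Finite.exists_equiv_fin σ
  obtain ⟨n', ⟨e'⟩⟩ := Finite.exists_equiv_fin (Fin n × VASS.Phase)
  set D := DFA.reindex g D₀ with hD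
  have hacc : D.accepts = D₀.accepts := by simp [hD]
  have hlang (x : ℕ) : (VASS.weakMachine e D ![2 ^ x, 0]).language =
      (VASS.cheatMachine e D e' ![2 ^ x, 0]).language ↔
        ¬ (Nat.Partrec.Code.eval (Denumerable.ofNat Nat.Partrec.Code x) 0).Dom := by
    rw [VASS.weakMachine_language_eq_iff, ← hR]
    simp only [hL, hacc]
  have hcode : Computable (fun x : ℕ => ((VASS.weakMachine e D ![2 ^ x, 0]).toCode,
      (VASS.cheatMachine e D e' ![2 ^ x, 0]).toCode)) := by
    -- Final configurations and transitions do not depend on the initial counters, so these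
    -- noncomputably chosen lists enter as constants, taken at the vector `0`.
    refine Primrec.to_comp (Primrec.pair ?_ ?_)
    · exact ((Primrec.const m).pair ((Primrec.const n).pair
        (((Primrec.const (D.start : ℕ)).pair primrec_two_pow_pair).pair
          (Primrec.const (VASS.weakMachine e D 0).toCode.2.2.2)))).of_eq fun _ => rfl
    · exact ((Primrec.const m).pair ((Primrec.const n').pair
        (((Primrec.const (e' (D.start, none) : ℕ)).pair primrec_two_pow_pair).pair
          (Primrec.const (VASS.cheatMachine e D e' 0).toCode.2.2.2)))).of_eq fun _ => rfl
  choose r hr hr' using fun x : ℕ => h m n n' _ _ _ _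
    (VASS.describes_toCode (VASS.weakMachine e D ![2 ^ x, 0]))
    (VASS.describes_toCode (VASS.cheatMachine e D e' ![2 ^ x, 0]))
    (VASS.weakMachine_isUnambiguous e D _)
  -- `f` may be partial, but it answers on every pair produced by the reduction, so the composite is
  -- total.
  have hcomp : Computable r := (hf.comp hcode).of_eq fun x => Part.eq_some_iff.2 (hr x)
  -- Equal languages mean that the program does not halt, hence the negation.
  refine ComputablePred.halting_problem 0 (ComputablePred.computable_iff.2
    ⟨fun c => !r (Encodable.encode c), ?_, funext fun c => propext ?_⟩)
  · exact Primrec.not.to_comp.comp (hcomp.comp Computable.encode)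
  · have := (hr' (Encodable.encode c)).trans (hlang _)
    rw [Denumerable.ofNat_encode] at this
    rw [Bool.not_eq_true', ← Bool.not_eq_true, this, not_not]
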